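/- Let $X_1,X_2,\dots$ be IID real random variables, let $X$ denote a generic increment, let $N$ be a random variable with values in $\{1,2,3,\dots\}$ that is independent of the sequence $(X_i)$, and put $S_N=\sum_{k=1}^N X_k$. A real random variable $Y$ is heavy-tailed if $E(e^{sY})=\infty$ for all $s>0$. A natural scale of a heavy-tailed random variable $Y$ is a concave function $h\colon[0,\infty)\to[0,\infty)$ with $h(0)=0$, $h(x)\to\infty$ as $x\to\infty$, and $$\liminf_{x\to\infty}\frac{-\log P(Y>x)}{h(x)}=1;$$ the set of natural scales of $Y$ is denoted by $\mathcal I(Y)$ (it is empty if $Y$ is not heavy-tailed). Suppose that $X$ and $N$ are heavy-tailed and $0<E(X)<\infty$. (1) Suppose that $E((X^+)^{1+\delta})<\infty$ for some $\delta>0$, and let $h_X\in\mathcal I(X)$ be such that $h_X(x)\ge(1+\delta)\log x$ for all large enough $x$. If $$\liminf_{x\to\infty}\frac{h_N(x/c_1)}{h_X(x)}\in[1,\infty]$$ for some $h_N\in\mathcal I(N)$ and some $c_1>E(X)$, then $h_X\in\mathcal I(S_N)$. (2) Suppose that $E(N^{1+\delta})<\infty$ for some $\delta>0$, and let $h_N\in\mathcal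 I(N)$ be such that $h_N(x)\ge(1+\delta)\log x$ for all large enough $x$. If $$\liminf_{x\to\infty}\frac{h_X(x)}{h_N(x/E(X))}\in[1,\infty]$$ for some $h_X\in\mathcal I(X)$, then the function $h_{E(X)N}(x):=h_N(x/E(X))$, which is a natural scale of $E(X)N$, is a natural scale of $S_N$: $h_{E(X)N}\in\mathcal I(E(X)N)\cap\mathcal I(S_N)$. -/

import Mathlib

open MeasureTheory ProbabilityTheory Filter

/-- A real random variable `Y` is (right) heavy-tailed if `E (exp (s Y)) = ∞` for all `s > 0`. -/
def HeavyTailed {Ω : Type*} [MeasurableSpace Ω] (P : Measure Ω) (Y : Ω → ℝ) : Prop :=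
  ∀ s : ℝ, 0 < s → ∫⁻ ω, ENNReal.ofReal (Real.exp (s * Y ω)) ∂P = ⊤

/-- The hazard function `R_Y(x) = -log P(Y > x)`, with value `⊤` where `P(Y > x) = 0`. -/
noncomputable def hazard {Ω : Type*} [MeasurableSpace Ω] (P : Measure Ω) (Y : Ω → ℝ) (x : ℝ) :
    EReal :=
  -ENNReal.log (P {ω | x < Y ω})

/-- `h` is a natural scale of `Y` (that is, `h ∈ 𝓘(Y)`): `Y` is heavy-tailed, `h` is a concave
function `[0, ∞) → [0, ∞)` with `h 0 = 0` and `h x → ∞` as `x → ∞`, and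
`liminf R_Y(x) / h x = 1` as `x → ∞`. The values of `h` at negative arguments play no role. -/
structure IsNaturalScale {Ω : Type*} [MeasurableSpace Ω] (P : Measure Ω) (Y : Ω → ℝ)
    (h : ℝ → ℝ) : Prop where
  heavyTailed : HeavyTailed P Y
  concaveOn : ConcaveOn ℝ (Set.Ici 0) h
  nonneg : ∀ x : ℝ, 0 ≤ x → 0 ≤ h x
  map_zero : h 0 = 0
  tendsto_atTop : Tendsto h atTop atTop
  liminf_eq : liminf (fun x : ℝ => hazard P Y x / (h x : EReal)) atTop = 1

/-- The randomly stopped sum `S_N = X₁ + ⋯ + X_N`; the increments are indexed from `0` here,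
so that `X 0` is the first increment. -/
def stoppedSum {Ω : Type*} (X : ℕ → Ω → ℝ) (N : Ω → ℕ) (ω : Ω) : ℝ :=
  ∑ i ∈ Finset.range (N ω), X i ω

/-! For a concave scale h, being a natural scale reduces to real tail bounds: for every ε the tail
is eventually at most exp(-(1-ε)h) and infinitely often at least exp(-(1+ε)h). A heavy tail
satisfying the upper bound forces h(x)/x → 0, and conversely a sublinear h with the lower bound
forces a heavy tail. Both parts then share one upper bound for S_N and differ only in the lower
bound.

Upper bound (`eventually_tail_stoppedSum_le`): suppose X and E(X)N both have tails at most
exp(-(1-ε)h), where h is sublinear and h(x) ≥ r log x with r > 1. Truncate X at level y and apply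
Chernoff's bound with a tilt s of order h(y)/y. Concavity keeps exp(st)P(X > t) below an integrable
function of t, independent of s and y, plus a tiny constant on (0, y) (`IsConcaveScale.exp_mul_le`).
Hence the truncated exponential moment is 1 + s(E(X) + o(1)) plus a controlled error; no second
moment is needed. The result is a Fuk–Nagaev bound C n exp(-(1-a)h(y)), uniform in n
(`eventually_tail_sum_le`). Conditioning on N, either E(X)N is nearly as large as x, or this bound
applies with y = x - cN. By concavity the latter costs exp(-(1-a)²h(x)) times an exponential moment
of truncated cN, estimated by the same truncation lemma.

Lower bound: when X dominates, one large summand suffices (`exists_mul_tail_le_tail_stoppedSum`).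
When N dominates, the law of large numbers gives S_N > cN with probability at least 1/2 for c < E(X)
and N large. -/

/-- A concave function `[0, ∞) → [0, ∞)` that vanishes at `0` and tends to infinity. -/
structure IsConcaveScale (h : ℝ → ℝ) : Prop where
  concaveOn : ConcaveOn ℝ (Set.Ici 0) h
  nonneg : ∀ x : ℝ, 0 ≤ x → 0 ≤ h x
  map_zero : h 0 = 0
  tendsto_atTop : Tendsto h atTop atTop

/-! ### Elementary inequalities for concave scales -/

namespace IsConcaveScale

variable {h : ℝ → ℝ}

/-- A concave function that decreased somewhere could not tend to infinity: compare with a far point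
w where h exceeds h x. -/
theorem mono (hh : IsConcaveScale h) {x y : ℝ} (hx : 0 ≤ x) (hxy : x ≤ y) : h x ≤ h y := by
  obtain ⟨w, hw, hyw⟩ := ((hh.tendsto_atTop.eventually_gt_atTop (h x)).and
    (eventually_ge_atTop y)).exists
  have := hh.concaveOn.min_le_of_mem_Icc (x := x) (y := w) (z := y) hx
    (hx.trans (hxy.trans hyw)) ⟨hxy, hyw⟩
  rwa [min_eq_left hw.le] at this

theorem mul_le (hh : IsConcaveScale h) {t x : ℝ} (ht0 : 0 ≤ t) (ht1 : t ≤ 1) (hx : 0 ≤ x) :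
    t * h x ≤ h (t * x) := by
  have := hh.concaveOn.2 (Set.mem_Ici.2 le_rfl) (Set.mem_Ici.2 hx)
    (sub_nonneg.2 ht1) ht0 (sub_add_cancel 1 t)
  simpa [hh.map_zero] using this

/-- The point z lies on the chord from kz to y, with weight on y between (1-k)z/y and z/y. The chord
from 0 would give only (z/y)h(y); starting at kz retains a term h(kz), which later supplies
integrability. -/
theorem chord_le (hh : IsConcaveScale h) {k z y : ℝ} (hk0 : 0 < k) (hk1 : k < 1) (hz : 0 < z)
    (hzy : z ≤ y) : (1 - z / y) * h (k * z) + (1 - k) * (z / y) * h y ≤ h z := by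
  have hy : 0 < y := hz.trans_le hzy
  have hkz : k * z < z := by nlinarith
  have hd : 0 < y - k * z := by linarith
  set l := (z - k * z) / (y - k * z) with hl
  have hl0 : 0 ≤ l := div_nonneg (by linarith) hd.le
  have hl1 : l ≤ z / y := by
    rw [hl, div_le_div_iff₀ hd hy]
    nlinarith [mul_nonneg (mul_nonneg hk0.le hz.le) (sub_nonneg.2 hzy)]
  have hl2 : (1 - k) * (z / y) ≤ l := by
    have : (1 - k) * (z / y) = (z - k * z) / y := by ring
    rw [this, hl]
    exact div_le_div_of_nonneg_left (by linarith) hd (by nlinarith)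
  have ht1 : z / y ≤ 1 := (div_le_one hy).2 hzy
  have key := hh.concaveOn.2 (Set.mem_Ici.2 (mul_pos hk0 hz).le) (Set.mem_Ici.2 hy.le)
    (sub_nonneg.2 (hl1.trans ht1)) hl0 (sub_add_cancel 1 l)
  have hcomb : (1 - l) • (k * z) + l • y = z := by
    have : l * (y - k * z) = z - k * z := by rw [hl, div_mul_cancel₀ _ hd.ne']
    simp only [smul_eq_mul]; linarith
  rw [hcomb] at key
  simp only [smul_eq_mul] at key
  have h1 := hh.nonneg (k * z) (by positivity)
  have h2 := hh.nonneg y hy.le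
  nlinarith [mul_le_mul_of_nonneg_right hl1 h1, mul_le_mul_of_nonneg_right hl2 h2]

theorem div_antitone (hh : IsConcaveScale h) {x y : ℝ} (hx : 0 < x) (hxy : x ≤ y) :
    h y / y ≤ h x / x := by
  have hy := hx.trans_le hxy
  have := hh.mul_le (t := x / y) (x := y) (by positivity) ((div_le_one hy).2 hxy) hy.le
  rw [div_mul_cancel₀ _ hy.ne'] at this
  rw [div_le_div_iff₀ hy hx]
  calc h y * x = (x / y * h y) * y := by field_simp
    _ ≤ h x * y := by gcongr

theorem comp_div (hh : IsConcaveScale h) {m : ℝ} (hm : 0 < m) :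
    IsConcaveScale (fun x => h (x / m)) where
  concaveOn := by
    refine ⟨convex_Ici 0, fun x hx y hy a b ha hb hab => ?_⟩
    have := hh.concaveOn.2 (Set.mem_Ici.2 (div_nonneg hx hm.le))
      (Set.mem_Ici.2 (div_nonneg hy hm.le)) ha hb hab
    convert this using 2
    simp only [smul_eq_mul]; ring
  nonneg x hx := hh.nonneg _ (by positivity)
  map_zero := by simpa using hh.map_zero
  tendsto_atTop := hh.tendsto_atTop.comp (tendsto_id.atTop_div_const hm)

end IsConcaveScale

/-! ### From extended-real hazard ratios to real tail bounds -/

section Hazard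

variable {Ω : Type*} [MeasurableSpace Ω] {P : Measure Ω}

theorem IsNaturalScale.isConcaveScale {Y : Ω → ℝ} {h : ℝ → ℝ} (hY : IsNaturalScale P Y h) :
    IsConcaveScale h :=
  ⟨hY.concaveOn, hY.nonneg, hY.map_zero, hY.tendsto_atTop⟩

theorem coe_le_hazard_iff [IsFiniteMeasure P] (Y : Ω → ℝ) (x r : ℝ) :
    (r : EReal) ≤ hazard P Y x ↔ P.real {ω | x < Y ω} ≤ Real.exp (-r) := by
  have h1 : ((-r : ℝ) : EReal) = ENNReal.log (ENNReal.ofReal (Real.exp (-r))) := by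
    rw [ENNReal.log_ofReal_of_pos (Real.exp_pos _), Real.log_exp]
  rw [hazard, EReal.le_neg, ← EReal.coe_neg, h1, ENNReal.log_le_log_iff, measureReal_def]
  exact ENNReal.le_ofReal_iff_toReal_le (measure_ne_top _ _) (Real.exp_pos _).le

theorem hazard_lt_coe_iff [IsFiniteMeasure P] (Y : Ω → ℝ) (x r : ℝ) :
    hazard P Y x < (r : EReal) ↔ Real.exp (-r) < P.real {ω | x < Y ω} := by
  rw [← not_le, coe_le_hazard_iff, not_le]

/-- Since h is eventually positive, the division can be cleared; points where the tail vanishes and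
the hazard is `⊤` satisfy the bound automatically. -/
theorem one_le_liminf_hazard_div_iff [IsFiniteMeasure P] {Y : Ω → ℝ} {h : ℝ → ℝ}
    (hh : Tendsto h atTop atTop) :
    1 ≤ liminf (fun x : ℝ => hazard P Y x / (h x : EReal)) atTop ↔
      ∀ ε : ℝ, 0 < ε → ∀ᶠ x in atTop, P.real {ω | x < Y ω} ≤ Real.exp (-((1 - ε) * h x)) := by
  rw [le_liminf_iff]
  constructor
  · intro H ε hε
    have := H ((1 - ε : ℝ) : EReal) (by exact_mod_cast (by linarith : 1 - ε < 1))
    filter_upwards [this, hh.eventually_gt_atTop 0] with x hx hpos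
    rw [EReal.lt_div_iff (by exact_mod_cast hpos) (EReal.coe_ne_top _), ← EReal.coe_mul] at hx
    exact (coe_le_hazard_iff _ _ _).1 hx.le
  · intro H y hy
    obtain ⟨c, hyc, hc⟩ := EReal.lt_iff_exists_real_btwn.1 hy
    have hc' : c < 1 := by exact_mod_cast hc
    filter_upwards [H (1 - c) (by linarith), hh.eventually_gt_atTop 0] with x hx hpos
    refine hyc.trans_le ?_
    rw [EReal.le_div_iff_mul_le (by exact_mod_cast hpos) (EReal.coe_ne_top _), ← EReal.coe_mul,
      coe_le_hazard_iff]
    simpa using hx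

theorem liminf_hazard_div_le_one_iff [IsFiniteMeasure P] {Y : Ω → ℝ} {h : ℝ → ℝ}
    (hh : Tendsto h atTop atTop) :
    liminf (fun x : ℝ => hazard P Y x / (h x : EReal)) atTop ≤ 1 ↔
      ∀ ε : ℝ, 0 < ε → ∃ᶠ x in atTop, Real.exp (-((1 + ε) * h x)) ≤ P.real {ω | x < Y ω} := by
  rw [liminf_le_iff]
  constructor
  · intro H ε hε
    have := H ((1 + ε : ℝ) : EReal) (by exact_mod_cast (by linarith : 1 < 1 + ε))
    refine (this.and_eventually (hh.eventually_gt_atTop 0)).mono fun x hx => ?_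
    obtain ⟨hx, hpos⟩ := hx
    rw [EReal.div_lt_iff (by exact_mod_cast hpos) (EReal.coe_ne_top _), ← EReal.coe_mul] at hx
    exact ((hazard_lt_coe_iff _ _ _).1 hx).le
  · intro H y hy
    obtain ⟨c, hc, hyc⟩ := EReal.lt_iff_exists_real_btwn.1 hy
    have hc' : 1 < c := by exact_mod_cast hc
    refine ((H ((c - 1) / 2) (by linarith)).and_eventually
      (hh.eventually_gt_atTop 0)).mono fun x hx => ?_
    obtain ⟨hx, hpos⟩ := hx
    refine lt_trans ?_ hyc
    rw [EReal.div_lt_iff (by exact_mod_cast hpos) (EReal.coe_ne_top _), ← EReal.coe_mul,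
      hazard_lt_coe_iff]
    refine lt_of_lt_of_le (Real.exp_lt_exp.2 ?_) hx
    nlinarith

theorem IsNaturalScale.eventually_tail_le [IsFiniteMeasure P] {Y : Ω → ℝ} {h : ℝ → ℝ}
    (hY : IsNaturalScale P Y h) {ε : ℝ} (hε : 0 < ε) :
    ∀ᶠ x in atTop, P.real {ω | x < Y ω} ≤ Real.exp (-((1 - ε) * h x)) :=
  (one_le_liminf_hazard_div_iff hY.tendsto_atTop).1 hY.liminf_eq.ge ε hε

theorem IsNaturalScale.frequently_le_tail [IsFiniteMeasure P] {Y : Ω → ℝ} {h : ℝ → ℝ}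
    (hY : IsNaturalScale P Y h) {ε : ℝ} (hε : 0 < ε) :
    ∃ᶠ x in atTop, Real.exp (-((1 + ε) * h x)) ≤ P.real {ω | x < Y ω} :=
  (liminf_hazard_div_le_one_iff hY.tendsto_atTop).1 hY.liminf_eq.le ε hε

theorem eventually_mul_le_of_one_le_liminf_div {f h : ℝ → ℝ} (hh : Tendsto h atTop atTop)
    (H : 1 ≤ liminf (fun x : ℝ => ((f x / h x : ℝ) : EReal)) atTop) {ε : ℝ} (hε : 0 < ε) :
    ∀ᶠ x in atTop, (1 - ε) * h x ≤ f x := by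
  rw [le_liminf_iff] at H
  have := H ((1 - ε : ℝ) : EReal) (by exact_mod_cast (by linarith : 1 - ε < 1))
  filter_upwards [this, hh.eventually_gt_atTop 0] with x hx hpos
  exact ((lt_div_iff₀ hpos).1 (by exact_mod_cast hx)).le

end Hazard

/-! ### Heavy tails and sublinearity of the scale -/

section HeavyTail

variable {Ω : Type*} [MeasurableSpace Ω] {P : Measure Ω}

/-- A finite exponential moment would bound exp(sx)P(Y > x) by Markov's inequality. At the given
points this product is at least exp(sx/2), because c h(x) ≤ sx/2 for large x. -/
theorem heavyTailed_of_frequently_le_tail [IsFiniteMeasure P] {Y : Ω → ℝ} (hYm : Measurable Y) {h : ℝ → ℝ}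
    (hsub : Tendsto (fun x => h x / x) atTop (nhds 0)) {c : ℝ} (hc : 0 < c)
    (H : ∃ᶠ x in atTop, Real.exp (-(c * h x)) ≤ P.real {ω | x < Y ω}) : HeavyTailed P Y := by
  intro s hs
  by_contra hne
  set E := ∫⁻ ω, ENNReal.ofReal (Real.exp (s * Y ω)) ∂P with hE
  have hexp : Tendsto (fun x : ℝ => Real.exp (s / 2 * x)) atTop atTop :=
    Real.tendsto_exp_atTop.comp (tendsto_id.const_mul_atTop (by positivity))
  obtain ⟨x, hx, hx0, hxh, hxe⟩ := (H.and_eventually ((eventually_gt_atTop 0).and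
    ((hsub.eventually_lt_const (show (0 : ℝ) < s / (2 * c) by positivity)).and
      (hexp.eventually_gt_atTop E.toReal)))).exists
  have hmarkov := mul_meas_ge_le_lintegral₀ (μ := P)
    (f := fun ω => ENNReal.ofReal (Real.exp (s * Y ω))) (by fun_prop)
    (ENNReal.ofReal (Real.exp (s * x)))
  have hsubset : P {ω | x < Y ω} ≤ P {ω | ENNReal.ofReal (Real.exp (s * x)) ≤
      ENNReal.ofReal (Real.exp (s * Y ω))} := by
    refine measure_mono fun ω hω => ENNReal.ofReal_le_ofReal (Real.exp_le_exp.2 ?_)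
    have : x < Y ω := hω
    nlinarith
  have h1 : ENNReal.ofReal (Real.exp (s * x)) * P {ω | x < Y ω} ≤ E :=
    (mul_le_mul_right hsubset _).trans hmarkov
  have h2 := ENNReal.toReal_mono hne h1
  rw [ENNReal.toReal_mul, ENNReal.toReal_ofReal (Real.exp_pos _).le, ← measureReal_def] at h2
  have h3 : Real.exp (s * x) * Real.exp (-(c * h x)) ≤ E.toReal :=
    (mul_le_mul_of_nonneg_left hx (Real.exp_pos _).le).trans h2
  rw [← Real.exp_add] at h3
  have h4 : c * h x ≤ s / 2 * x := by
    rw [div_lt_iff₀ hx0] at hxh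
    calc c * h x ≤ c * (s / (2 * c) * x) := by gcongr
      _ = s / 2 * x := by field_simp
  have := Real.exp_le_exp.2 (show s / 2 * x ≤ s * x + -(c * h x) by linarith)
  linarith

variable [IsProbabilityMeasure P]

theorem not_heavyTailed_of_exp_tail {Y : Ω → ℝ} (hYm : Measurable Y) {A c : ℝ} (hc : 0 < c)
    (hA : ∀ x, 0 ≤ x → P.real {ω | x < Y ω} ≤ A * Real.exp (-(c * x))) :
    ¬ HeavyTailed P Y := by
  intro H
  have := H (c / 2) (by positivity)
  have hA0 : 0 ≤ A := by
    have := (measureReal_nonneg).trans (hA 0 le_rfl)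
    simpa using this
  refine absurd this (ne_of_lt ?_)
  rw [lintegral_eq_lintegral_meas_lt P (Eventually.of_forall fun ω => (Real.exp_pos _).le)
    (by fun_prop)]
  have hsplit : Set.Ioi (0 : ℝ) = Set.Ioc 0 1 ∪ Set.Ioi 1 := by simp
  rw [hsplit]
  refine (lintegral_union_le _ _ _).trans_lt (ENNReal.add_lt_top.2 ⟨?_, ?_⟩)
  · calc _ ≤ ∫⁻ t in Set.Ioc (0 : ℝ) 1, 1 := by gcongr; exact prob_le_one
      _ < ⊤ := by simp
  -- The exponent c/2 makes the tail of exp(cY/2) at level t at most A t⁻², which is integrable at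
  -- infinity.
  · have hint : IntegrableOn (fun t : ℝ => A * t ^ (-2 : ℝ)) (Set.Ioi 1) :=
      (integrableOn_Ioi_rpow_of_lt (by norm_num) one_pos).const_mul A
    refine lt_of_le_of_lt (setLIntegral_mono' measurableSet_Ioi fun t ht => ?_)
      hint.lintegral_lt_top
    have ht : 1 < t := ht
    have ht0 : 0 < t := by linarith
    have hset : {ω | t < Real.exp (c / 2 * Y ω)} = {ω | Real.log t / (c / 2) < Y ω} := by
      ext ω
      simp only [Set.mem_ofPred_eq]
      rw [← Real.log_lt_iff_lt_exp ht0, div_lt_iff₀ (by positivity), mul_comm]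
    rw [hset, ENNReal.le_ofReal_iff_toReal_le (measure_ne_top _ _) (by positivity)]
    refine (hA _ (div_nonneg (Real.log_nonneg ht.le) (by positivity))).trans (le_of_eq ?_)
    rw [Real.rpow_def_of_pos ht0]
    congr 2
    field_simp

theorem exists_const_tail_le {Y : Ω → ℝ} {h : ℝ → ℝ} {c : ℝ} (hh : IsConcaveScale h) (hc : 0 ≤ c)
    (H : ∀ᶠ x in atTop, P.real {ω | x < Y ω} ≤ Real.exp (-(c * h x))) :
    ∃ A : ℝ, 0 < A ∧ ∀ x, 0 ≤ x → P.real {ω | x < Y ω} ≤ A * Real.exp (-(c * h x)) := by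
  obtain ⟨x0, hx0⟩ := eventually_atTop.1 H
  refine ⟨max 1 (Real.exp (c * h x0)), by positivity, fun x hx => ?_⟩
  rcases le_total x0 x with h1 | h1
  · exact (hx0 x h1).trans (le_mul_of_one_le_left (Real.exp_pos _).le (le_max_left _ _))
  · calc P.real {ω | x < Y ω} ≤ 1 := measureReal_le_one
      _ ≤ Real.exp (c * h x0) * Real.exp (-(c * h x)) := by
        rw [← Real.exp_add, Real.one_le_exp_iff]
        have := mul_le_mul_of_nonneg_left (hh.mono hx h1) hc
        linarith
      _ ≤ _ := by gcongr; exact le_max_right _ _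

/-- The ratio h(x)/x is nonincreasing, so if it does not tend to 0 it stays above some η > 0. The
tail is then exponentially small, contradicting heaviness. -/
theorem HeavyTailed.tendsto_div_zero {Y : Ω → ℝ} (hYm : Measurable Y) (hY : HeavyTailed P Y)
    {h : ℝ → ℝ} {c : ℝ} (hh : IsConcaveScale h) (hc : 0 < c)
    (H : ∀ᶠ x in atTop, P.real {ω | x < Y ω} ≤ Real.exp (-(c * h x))) :
    Tendsto (fun x => h x / x) atTop (nhds 0) := by
  rw [Metric.tendsto_atTop]
  by_contra hcon
  push Not at hcon
  obtain ⟨η, hη, hcon⟩ := hcon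
  have hlin : ∀ x, 0 ≤ x → η * x ≤ h x := by
    intro x hx
    rcases hx.eq_or_lt with rfl | hx
    · simp [hh.map_zero]
    · obtain ⟨y, hy, hyη⟩ := hcon x
      have hy0 := hx.trans_le hy
      rw [Real.dist_eq, sub_zero, abs_of_nonneg (div_nonneg (hh.nonneg y hy0.le) hy0.le)] at hyη
      exact (le_div_iff₀ hx).1 (hyη.trans (hh.div_antitone hx hy))
  obtain ⟨A, hA0, hA⟩ := exists_const_tail_le hh hc.le H
  refine not_heavyTailed_of_exp_tail (A := A) (c := c * η) hYm (by positivity)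
    (fun x hx => (hA x hx).trans ?_) hY
  refine mul_le_mul_of_nonneg_left (Real.exp_le_exp.2 (neg_le_neg ?_)) hA0.le
  rw [mul_assoc]
  exact mul_le_mul_of_nonneg_left (hlin x hx) hc.le

end HeavyTail

/-! ### First-order expansion of truncated exponential moments -/

section TruncatedMoment

theorem integral_mul_exp_sub_one (s z : ℝ) :
    ∫ t in (0 : ℝ)..z, s * (Real.exp (s * t) - 1) = Real.exp (s * z) - 1 - s * z := by
  have hd : ∀ t ∈ Set.uIcc 0 z, HasDerivAt (fun t => Real.exp (s * t) - s * t)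
      (s * (Real.exp (s * t) - 1)) t := by
    intro t _
    have h1 : HasDerivAt (fun t : ℝ => s * t) s t := by
      simpa using (hasDerivAt_id t).const_mul s
    have h2 := h1.exp.sub h1
    rwa [show Real.exp (s * t) * s - s = s * (Real.exp (s * t) - 1) by ring] at h2
  rw [intervalIntegral.integral_eq_sub_of_hasDerivAt hd
    ((by fun_prop : Continuous fun t => s * (Real.exp (s * t) - 1)).intervalIntegrable _ _)]
  simp
  ring

variable {Ω : Type*} [MeasurableSpace Ω] {P : Measure Ω}

theorem integrable_min_mul {G : ℝ → ℝ} (hG : IntegrableOn G (Set.Ioi 0)) {s : ℝ} (hs : 0 ≤ s) :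
    IntegrableOn (fun t => min 1 (s * t) * G t) (Set.Ioi 0) := by
  refine Integrable.mono hG
    ((by fun_prop : Continuous fun t : ℝ => min 1 (s * t)).aestronglyMeasurable.mul hG.1) ?_
  refine (ae_restrict_iff' measurableSet_Ioi).2 (Eventually.of_forall fun t ht => ?_)
  have ht : (0 : ℝ) < t := ht
  rw [norm_mul]
  refine mul_le_of_le_one_left (norm_nonneg _) ?_
  rw [Real.norm_of_nonneg (le_min zero_le_one (by positivity))]
  exact min_le_left _ _

theorem tendsto_integral_min_mul {G : ℝ → ℝ} (hG : IntegrableOn G (Set.Ioi 0)) :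
    Tendsto (fun s : ℝ => ∫ t in Set.Ioi 0, min 1 (s * t) * G t) (nhdsWithin 0 (Set.Ioi 0))
      (nhds 0) := by
  have : Tendsto (fun s : ℝ => ∫ t in Set.Ioi 0, min 1 (s * t) * G t)
      (nhdsWithin 0 (Set.Ioi 0)) (nhds (∫ t in Set.Ioi (0 : ℝ), 0)) := by
    refine tendsto_integral_filter_of_dominated_convergence (fun t => ‖G t‖) ?_ ?_ hG.norm ?_
    · filter_upwards [self_mem_nhdsWithin] with s hs
      exact (integrable_min_mul hG (le_of_lt hs)).1
    · filter_upwards [self_mem_nhdsWithin] with s hs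
      refine (ae_restrict_iff' measurableSet_Ioi).2 (Eventually.of_forall fun t ht => ?_)
      have ht : (0 : ℝ) < t := ht
      have hs : (0 : ℝ) < s := hs
      rw [norm_mul]
      refine mul_le_of_le_one_left (norm_nonneg _) ?_
      rw [Real.norm_of_nonneg (le_min zero_le_one (by positivity))]
      exact min_le_left _ _
    · refine Eventually.of_forall fun t => ?_
      have hc : Continuous fun s : ℝ => min 1 (s * t) * G t := by fun_prop
      have := (hc.tendsto 0).mono_left (nhdsWithin_le_nhds (s := Set.Ioi 0))
      simpa using this
  simpa using this

/-- Layer-cake formula for w ↦ exp(sw) - 1 - sw, whose derivative is s(exp(st) - 1). The integrable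
part G of the tilted tail keeps the damping factor min(1, st), so its contribution is o(s). -/
theorem integral_exp_min_pos_part_le [IsProbabilityMeasure P] {X : Ω → ℝ} (hXm : Measurable X) {G : ℝ → ℝ}
    (hG : IntegrableOn G (Set.Ioi 0)) (hG0 : ∀ t, 0 < t → 0 ≤ G t) {s y D : ℝ} (hs : 0 ≤ s)
    (hy : 0 ≤ y) (hD : 0 ≤ D)
    (hb : ∀ t, 0 < t → t < y → Real.exp (s * t) * P.real {ω | t < X ω} ≤ G t + D) :
    ∫ ω, (Real.exp (s * min (max (X ω) 0) y) - 1 - s * min (max (X ω) 0) y) ∂P ≤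
      s * ((∫ t in Set.Ioi 0, min 1 (s * t) * G t) + D * y) := by
  have hI := integrable_min_mul hG hs
  have hJ : IntegrableOn (Set.indicator (Set.Ioo 0 y) (fun _ => D)) (Set.Ioi 0) := by
    refine (IntegrableOn.integrable_indicator ?_ measurableSet_Ioo).integrableOn
    simp
  have hJint : ∫ t in Set.Ioi 0, Set.indicator (Set.Ioo 0 y) (fun _ => D) t = D * y := by
    rw [setIntegral_indicator measurableSet_Ioo, Set.inter_eq_right.2 Set.Ioo_subset_Ioi_self]
    simp [hy, mul_comm]
  have hrhs : s * ((∫ t in Set.Ioi 0, min 1 (s * t) * G t) + D * y) =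
      ∫ t in Set.Ioi 0, s * (min 1 (s * t) * G t + Set.indicator (Set.Ioo 0 y) (fun _ => D) t) := by
    rw [integral_const_mul, integral_add hI hJ, hJint]
  have hnn : ∀ t, 0 < t →
      0 ≤ s * (min 1 (s * t) * G t + Set.indicator (Set.Ioo 0 y) (fun _ => D) t) := by
    intro t ht
    refine mul_nonneg hs (add_nonneg (mul_nonneg (le_min zero_le_one (by positivity)) (hG0 t ht)) ?_)
    exact Set.indicator_nonneg (fun _ _ => hD) _
  have hnn' : 0 ≤ᵐ[volume.restrict (Set.Ioi (0 : ℝ))] fun t =>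
      s * (min 1 (s * t) * G t + Set.indicator (Set.Ioo 0 y) (fun _ => D) t) :=
    (ae_restrict_iff' measurableSet_Ioi).2 (Eventually.of_forall hnn)
  rw [hrhs, integral_eq_lintegral_of_nonneg_ae
    (Eventually.of_forall fun ω => by
      have := Real.add_one_le_exp (s * min (max (X ω) 0) y)
      simp only [Pi.zero_apply]; linarith) (by fun_prop)]
  refine ENNReal.toReal_le_of_le_ofReal (integral_nonneg_of_ae hnn') ?_
  have hint : Integrable (fun t => s * (min 1 (s * t) * G t +
      Set.indicator (Set.Ioo 0 y) (fun _ => D) t)) (volume.restrict (Set.Ioi 0)) :=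
    (hI.add hJ).const_mul s
  rw [ofReal_integral_eq_lintegral_ofReal hint hnn']
  have hlc := lintegral_comp_eq_lintegral_meas_lt_mul P (f := fun ω => min (max (X ω) 0) y)
    (g := fun t => s * (Real.exp (s * t) - 1))
    (Eventually.of_forall fun ω => le_min (le_max_right _ _) hy) (by fun_prop)
    (fun t _ => (by fun_prop : Continuous fun t => s * (Real.exp (s * t) - 1)).intervalIntegrable _ _)
    ((ae_restrict_iff' measurableSet_Ioi).2 (Eventually.of_forall fun t ht => by
      have ht : (0 : ℝ) < t := ht
      have : 0 ≤ s * t := by positivity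
      have := Real.add_one_le_exp (s * t)
      exact mul_nonneg hs (by linarith)))
  simp only [integral_mul_exp_sub_one] at hlc
  rw [hlc]
  refine setLIntegral_mono' measurableSet_Ioi fun t ht => ?_
  have ht : (0 : ℝ) < t := ht
  rcases lt_or_ge t y with hty | hty
  · have hset : {ω | t < min (max (X ω) 0) y} = {ω | t < X ω} := by
      ext ω; simp [ht.not_gt, hty]
    have hst : 0 ≤ s * t := by positivity
    have he := Real.add_one_le_exp (s * t)
    rw [hset, ← ofReal_measureReal, ← ENNReal.ofReal_mul measureReal_nonneg]
    refine ENNReal.ofReal_le_ofReal ?_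
    rw [Set.indicator_of_mem (show t ∈ Set.Ioo 0 y from ⟨ht, hty⟩)]
    -- From exp(st) - 1 = exp(st)(1 - exp(-st)), the second factor is the damping.
    have h1 : 1 - Real.exp (-(s * t)) ≤ min 1 (s * t) := by
      refine le_min (by linarith [Real.exp_pos (-(s * t))]) ?_
      linarith [Real.add_one_le_exp (-(s * t))]
    have h0 : 0 ≤ 1 - Real.exp (-(s * t)) := by
      have := Real.exp_le_one_iff.2 (neg_nonpos.2 hst)
      linarith
    have h2 : Real.exp (s * t) - 1 = Real.exp (s * t) * (1 - Real.exp (-(s * t))) := by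
      rw [mul_sub, ← Real.exp_add]; simp
    calc P.real {ω | t < X ω} * (s * (Real.exp (s * t) - 1))
        = s * ((1 - Real.exp (-(s * t))) * (Real.exp (s * t) * P.real {ω | t < X ω})) := by
          rw [h2]; ring
      _ ≤ s * ((1 - Real.exp (-(s * t))) * (G t + D)) := by
          gcongr; exact hb t ht hty
      _ = s * ((1 - Real.exp (-(s * t))) * G t + (1 - Real.exp (-(s * t))) * D) := by ring
      _ ≤ s * (min 1 (s * t) * G t + D) := by
          have := mul_le_mul_of_nonneg_right h1 (hG0 t ht)
          have : (1 - Real.exp (-(s * t))) * D ≤ D :=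
            mul_le_of_le_one_left hD (by linarith [Real.exp_pos (-(s * t))])
          gcongr
  · have hset : {ω | t < min (max (X ω) 0) y} = ∅ := by
      ext ω; simp [hty]
    rw [hset]; simp

/-- For u ≤ 0 the quotient lies between 0 and |u|, so one moment suffices for dominated convergence.
-/
theorem tendsto_integral_exp_neg_part {X : Ω → ℝ} (hX : Integrable X P) :
    Tendsto (fun s : ℝ => ∫ ω, (Real.exp (s * min (X ω) 0) - 1 - s * min (X ω) 0) / s ∂P)
      (nhdsWithin 0 (Set.Ioi 0)) (nhds 0) := by
  have hmin : Integrable (fun ω => min (X ω) 0) P := hX.inf (integrable_zero _ _ _)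
  have : Tendsto (fun s : ℝ => ∫ ω, (Real.exp (s * min (X ω) 0) - 1 - s * min (X ω) 0) / s ∂P)
      (nhdsWithin 0 (Set.Ioi 0)) (nhds (∫ _, (0 : ℝ) ∂P)) := by
    refine tendsto_integral_filter_of_dominated_convergence (fun ω => ‖min (X ω) 0‖) ?_ ?_
      hmin.norm ?_
    · refine Eventually.of_forall fun s => ?_
      have h1 : AEStronglyMeasurable (fun ω => s * min (X ω) 0) P := hmin.1.const_mul s
      exact (((Real.continuous_exp.comp_aestronglyMeasurable h1).sub
        aestronglyMeasurable_const).sub h1).div₀ aestronglyMeasurable_const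
    · filter_upwards [self_mem_nhdsWithin] with s hs
      have hs : (0 : ℝ) < s := hs
      refine Eventually.of_forall fun ω => ?_
      have hu : min (X ω) 0 ≤ 0 := min_le_right _ _
      have h1 := Real.add_one_le_exp (s * min (X ω) 0)
      have h2 := Real.exp_le_one_iff.2 (mul_nonpos_of_nonneg_of_nonpos hs.le hu)
      rw [Real.norm_of_nonneg (div_nonneg (by linarith) hs.le), Real.norm_of_nonpos hu,
        div_le_iff₀ hs]
      linarith
    · refine Eventually.of_forall fun ω => ?_
      set u := min (X ω) 0
      have hd : HasDerivAt (fun s : ℝ => Real.exp (s * u)) u 0 := by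
        have h1 : HasDerivAt (fun s : ℝ => s * u) u 0 := by
          simpa using (hasDerivAt_id (0 : ℝ)).mul_const u
        simpa using h1.exp
      have hslope := (hasDerivAt_iff_tendsto_slope.1 hd).mono_left
        (nhdsWithin_mono 0 (fun x (hx : 0 < x) => ne_of_gt hx : Set.Ioi (0 : ℝ) ⊆ {0}ᶜ))
      have h2 := hslope.sub_const u
      rw [sub_self] at h2
      refine h2.congr' ?_
      filter_upwards [self_mem_nhdsWithin] with s hs
      have hs : (0 : ℝ) < s := hs
      rw [slope_def_field]
      simp only [zero_mul, Real.exp_zero, sub_zero]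
      field_simp
  simpa using this

theorem exists_integral_exp_min_le [IsProbabilityMeasure P] {X : Ω → ℝ} (hXm : Measurable X) (hX : Integrable X P)
    {G : ℝ → ℝ} (hG : IntegrableOn G (Set.Ioi 0)) (hG0 : ∀ t, 0 < t → 0 ≤ G t) {η : ℝ}
    (hη : 0 < η) :
    ∃ s₀ : ℝ, 0 < s₀ ∧ ∀ s y D : ℝ, 0 < s → s < s₀ → 0 ≤ y → 0 ≤ D →
      (∀ t, 0 < t → t < y → Real.exp (s * t) * P.real {ω | t < X ω} ≤ G t + D) →
      ∫ ω, Real.exp (s * min (X ω) y) ∂P ≤ 1 + s * ((∫ ω, X ω ∂P) + η + D * y) := by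
  have h1 := (tendsto_integral_min_mul hG).eventually_lt_const (half_pos hη)
  have h2 := (tendsto_integral_exp_neg_part hX).eventually_lt_const (half_pos hη)
  obtain ⟨s₀, hs₀, hs⟩ := mem_nhdsGT_iff_exists_Ioo_subset.1 (h1.and h2)
  refine ⟨s₀, hs₀, fun s y D hs0 hss hy hD hb => ?_⟩
  obtain ⟨h3, h4⟩ := hs ⟨hs0, hss⟩
  have h5 := integral_exp_min_pos_part_le hXm hG hG0 hs0.le hy hD hb
  have hmin : Integrable (fun ω => min (X ω) 0) P := hX.inf (integrable_zero _ _ _)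
  have hpos : Integrable (fun ω => min (max (X ω) 0) y) P :=
    (hX.sup (integrable_zero _ _ _)).inf (integrable_const y)
  have hminy : Integrable (fun ω => min (X ω) y) P := hX.inf (integrable_const y)
  have i1 : Integrable (fun ω => Real.exp (s * min (max (X ω) 0) y) - 1 -
      s * min (max (X ω) 0) y) P := by
    refine ((Integrable.of_bound (by fun_prop) (Real.exp (s * y))
      (Eventually.of_forall fun ω => ?_)).sub (integrable_const 1)).sub (hpos.const_mul s)
    rw [Real.norm_of_nonneg (Real.exp_pos _).le]
    exact Real.exp_le_exp.2 (mul_le_mul_of_nonneg_left (min_le_right _ _) hs0.le)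
  have i2 : Integrable (fun ω => Real.exp (s * min (X ω) 0) - 1 - s * min (X ω) 0) P := by
    refine ((Integrable.of_bound (by fun_prop) 1
      (Eventually.of_forall fun ω => ?_)).sub (integrable_const 1)).sub (hmin.const_mul s)
    rw [Real.norm_of_nonneg (Real.exp_pos _).le]
    exact Real.exp_le_one_iff.2 (mul_nonpos_of_nonneg_of_nonpos hs0.le (min_le_right _ _))
  -- Positive and negative parts are never both nonzero, so the second-order remainders simply add.
  have heq : ∀ ω, Real.exp (s * min (X ω) y) = 1 + s * min (X ω) y +
      (Real.exp (s * min (max (X ω) 0) y) - 1 - s * min (max (X ω) 0) y) +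
      (Real.exp (s * min (X ω) 0) - 1 - s * min (X ω) 0) := by
    intro ω
    rcases le_total (X ω) 0 with h | h
    · rw [max_eq_right h, min_eq_left h, min_eq_left hy, min_eq_left (h.trans hy)]
      simp
    · rw [max_eq_left h, min_eq_right h]
      simp
  rw [integral_div, div_lt_iff₀ hs0] at h4
  have h6 : ∫ ω, min (X ω) y ∂P ≤ ∫ ω, X ω ∂P :=
    integral_mono hminy hX fun ω => min_le_left _ _
  calc ∫ ω, Real.exp (s * min (X ω) y) ∂P
      = 1 + s * (∫ ω, min (X ω) y ∂P) +
        (∫ ω, (Real.exp (s * min (max (X ω) 0) y) - 1 - s * min (max (X ω) 0) y) ∂P) +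
        ∫ ω, (Real.exp (s * min (X ω) 0) - 1 - s * min (X ω) 0) ∂P := by
        have i3 : Integrable (fun ω => 1 + s * min (X ω) y) P :=
          (integrable_const 1).add (hminy.const_mul s)
        have i4 : Integrable (fun ω => 1 + s * min (X ω) y +
            (Real.exp (s * min (max (X ω) 0) y) - 1 - s * min (max (X ω) 0) y)) P := i3.add i1
        rw [integral_congr_ae (Eventually.of_forall heq), integral_add i4 i2, integral_add i3 i1,
          integral_add (integrable_const 1) (hminy.const_mul s), integral_const_mul]
        simp
    _ ≤ 1 + s * (∫ ω, X ω ∂P) + s * (η / 2 + D * y) + η / 2 * s := by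
        have h7 := mul_le_mul_of_nonneg_left h6 hs0.le
        have h8 : s * ((∫ t in Set.Ioi 0, min 1 (s * t) * G t) + D * y) ≤ s * (η / 2 + D * y) := by
          gcongr
        linarith
    _ = _ := by ring

end TruncatedMoment

/-! ### Tilted tails under a concave scale -/

namespace IsConcaveScale

variable {h : ℝ → ℝ}

/-- With r = t/y, the chord inequality bounds the exponent st - p h(t) by the (1-r, r) combination
of the two target exponents, and convexity of exp separates them. The parameter b is spare decay,
later set to log n or log x. -/
theorem exp_mul_le (hh : IsConcaveScale h) {k p q b s A F t y : ℝ} (hk0 : 0 < k) (hk1 : k < 1)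
    (hp : 0 ≤ p) (hA : 0 ≤ A) (ht : 0 < t) (hty : t ≤ y) (hF : F ≤ A * Real.exp (-(p * h t)))
    (hs : s * y ≤ q * h y - b) :
    Real.exp (s * t) * F ≤
      A * Real.exp (-(p * h (k * t))) + A * Real.exp (-(b + (p * (1 - k) - q) * h y)) := by
  have hy := ht.trans_le hty
  set r := t / y with hr
  have hr0 : 0 ≤ r := by positivity
  have hr1 : r ≤ 1 := (div_le_one hy).2 hty
  have hst : s * t ≤ r * (q * h y - b) := by
    calc s * t = r * (s * y) := by rw [hr]; field_simp
      _ ≤ _ := by gcongr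
  have hch := mul_le_mul_of_nonneg_left (hh.chord_le hk0 hk1 ht hty) hp
  rw [← hr] at hch
  have hexp : s * t + -(p * h t) ≤ (1 - r) * (-(p * h (k * t))) +
      r * (-(b + (p * (1 - k) - q) * h y)) := by
    nlinarith
  have hconv := convexOn_exp.2 (Set.mem_univ (-(p * h (k * t))))
    (Set.mem_univ (-(b + (p * (1 - k) - q) * h y))) (sub_nonneg.2 hr1) hr0 (sub_add_cancel 1 r)
  simp only [smul_eq_mul] at hconv
  have h1 := Real.exp_pos (-(p * h (k * t)))
  have h2 := Real.exp_pos (-(b + (p * (1 - k) - q) * h y))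
  calc Real.exp (s * t) * F ≤ Real.exp (s * t) * (A * Real.exp (-(p * h t))) := by gcongr
    _ = A * Real.exp (s * t + -(p * h t)) := by rw [Real.exp_add]; ring
    _ ≤ A * (Real.exp (-(p * h (k * t))) + Real.exp (-(b + (p * (1 - k) - q) * h y))) := by
      refine mul_le_mul_of_nonneg_left (((Real.exp_le_exp.2 hexp).trans hconv).trans ?_) hA
      nlinarith
    _ = _ := mul_add _ _ _

theorem integrableOn_exp_neg (hh : IsConcaveScale h) {q k p : ℝ}
    (hlog : ∀ᶠ x : ℝ in atTop, q * Real.log x ≤ h x) (hk : 0 < k) (hp : 0 < p) (hpq : 1 < p * q) :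
    IntegrableOn (fun t => Real.exp (-(p * h (k * t)))) (Set.Ioi 0) := by
  have hmono : MonotoneOn (fun t => h (k * t)) (Set.Ioi 0) := fun x hx y _ hxy =>
    hh.mono (mul_pos hk hx).le (mul_le_mul_of_nonneg_left hxy hk.le)
  have hmeas : AEMeasurable (fun t => Real.exp (-(p * h (k * t))))
      (volume.restrict (Set.Ioi 0)) :=
    ((aemeasurable_restrict_of_monotoneOn measurableSet_Ioi hmono).const_mul p).neg.exp
  obtain ⟨x0, hx0⟩ := eventually_atTop.1
    ((tendsto_id.const_mul_atTop hk).eventually hlog)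
  set x1 := max x0 1
  have hx1 : 0 < x1 := lt_of_lt_of_le one_pos (le_max_right _ _)
  rw [← Set.Ioc_union_Ioi_eq_Ioi hx1.le]
  refine IntegrableOn.union ?_ ?_
  · refine IntegrableOn.of_bound (by simp)
      (hmeas.mono_set Set.Ioc_subset_Ioi_self).aestronglyMeasurable 1 ?_
    refine (ae_restrict_iff' measurableSet_Ioc).2 (Eventually.of_forall fun t ht => ?_)
    rw [Real.norm_of_nonneg (Real.exp_pos _).le, Real.exp_le_one_iff]
    have := hh.nonneg (k * t) (mul_pos hk ht.1).le
    nlinarith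
  · have hint : IntegrableOn (fun t : ℝ => k ^ (-(p * q)) * t ^ (-(p * q))) (Set.Ioi x1) :=
      (integrableOn_Ioi_rpow_of_lt (by linarith) hx1).const_mul _
    refine Integrable.mono' hint
      (hmeas.mono_set (Set.Ioi_subset_Ioi hx1.le)).aestronglyMeasurable ?_
    refine (ae_restrict_iff' measurableSet_Ioi).2 (Eventually.of_forall fun t ht => ?_)
    have ht : x1 < t := ht
    have ht0 : 0 < t := hx1.trans ht
    rw [Real.norm_of_nonneg (Real.exp_pos _).le, ← Real.mul_rpow hk.le ht0.le,
      Real.rpow_def_of_pos (mul_pos hk ht0), Real.exp_le_exp]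
    have := mul_le_mul_of_nonneg_left (hx0 t ((le_max_left _ _).trans ht.le)) hp.le
    simp only [id] at this
    nlinarith

end IsConcaveScale

/-! ### A Fuk–Nagaev bound for deterministic sums -/

section Sums

variable {Ω : Type*} [MeasurableSpace Ω] {P : Measure Ω} [IsProbabilityMeasure P] {h : ℝ → ℝ}

theorem integrable_of_tail_le {Z : Ω → ℝ} (hZm : Measurable Z) (hZ : ∀ ω, 0 ≤ Z ω)
    (hh : IsConcaveScale h) {q p A : ℝ} (hlog : ∀ᶠ x : ℝ in atTop, q * Real.log x ≤ h x)
    (hp : 0 < p) (hpq : 1 < p * q) (hA0 : 0 ≤ A)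
    (hA : ∀ x, 0 ≤ x → P.real {ω | x < Z ω} ≤ A * Real.exp (-(p * h x))) : Integrable Z P := by
  have hG := (hh.integrableOn_exp_neg hlog one_pos hp hpq).const_mul A
  refine ⟨hZm.aestronglyMeasurable, ?_⟩
  rw [hasFiniteIntegral_iff_ofReal (Eventually.of_forall hZ),
    lintegral_eq_lintegral_meas_lt P (Eventually.of_forall hZ) hZm.aemeasurable]
  refine lt_of_le_of_lt (setLIntegral_mono' measurableSet_Ioi fun t ht => ?_)
    hG.lintegral_lt_top
  rw [ENNReal.le_ofReal_iff_toReal_le (measure_ne_top _ _) (by positivity), one_mul]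
  exact hA t (le_of_lt ht)

theorem eventually_integral_exp_min_le {X : Ω → ℝ} (hXm : Measurable X) (hX : Integrable X P)
    (hh : IsConcaveScale h) (hsub : Tendsto (fun x => h x / x) atTop (nhds 0)) {r k p q A η : ℝ}
    (hlog : ∀ᶠ x : ℝ in atTop, r * Real.log x ≤ h x) (hk0 : 0 < k) (hk1 : k < 1) (hp : 0 < p)
    (hpr : 1 < p * r) (hq : q ≤ 1) (hA0 : 0 ≤ A)
    (hA : ∀ x, 0 ≤ x → P.real {ω | x < X ω} ≤ A * Real.exp (-(p * h x))) (hη : 0 < η) :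
    ∀ᶠ y in atTop, ∀ b s : ℝ, 0 ≤ b → 0 < s → s * y ≤ q * h y - b →
      ∫ ω, Real.exp (s * min (X ω) y) ∂P ≤
        1 + s * ((∫ ω, X ω ∂P) + η + A * Real.exp (-(b + (p * (1 - k) - q) * h y)) * y) := by
  obtain ⟨s₀, hs₀, H⟩ := exists_integral_exp_min_le hXm hX
    ((hh.integrableOn_exp_neg hlog hk0 hp hpr).const_mul A) (fun t _ => by positivity) hη
  -- Since q ≤ 1 and b ≥ 0, s ≤ h(y)/y, so sublinearity makes every admissible tilt small at once.
  filter_upwards [hsub.eventually_lt_const hs₀, eventually_gt_atTop 0] with y hy hy0 b s hb hs hsy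
  refine H s y _ hs (lt_of_le_of_lt ?_ hy) hy0.le (by positivity) fun t ht hty =>
    hh.exp_mul_le hk0 hk1 hp.le hA0 ht hty.le (hA t ht.le) hsy
  rw [le_div_iff₀ hy0]
  nlinarith [hh.nonneg y hy0.le]

theorem mul_exp_neg_mul_le {e u : ℝ} (he : 0 < e) : u * Real.exp (-(e * u)) ≤ 1 / e := by
  rw [Real.exp_neg, ← div_eq_mul_inv, div_le_div_iff₀ (Real.exp_pos _) he]
  linarith [Real.add_one_le_exp (e * u)]

variable {X : ℕ → Ω → ℝ}

/-- Either some summand exceeds y, or the sum equals that of the summands truncated at y, to which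
Chernoff's bound applies. -/
theorem tail_sum_le_of_mgf (hXm : ∀ i, Measurable (X i)) (hindep : iIndepFun X P)
    (hident : ∀ i, IdentDistrib (X i) (X 0) P P) {s : ℝ} (hs : 0 ≤ s) (x y : ℝ) (n : ℕ) :
    P.real {ω | x < ∑ i ∈ Finset.range n, X i ω} ≤ n * P.real {ω | y < X 0 ω} +
      Real.exp (-s * x) * (∫ ω, Real.exp (s * min (X 0 ω) y) ∂P) ^ n := by
  set Y : ℕ → Ω → ℝ := fun i ω => min (X i ω) y with hY
  have hYm : ∀ i, Measurable (Y i) := fun i => (hXm i).min measurable_const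
  have hYindep : iIndepFun Y P :=
    hindep.comp (fun _ u => min u y) (fun _ => measurable_id.min measurable_const)
  have hsubset : {ω | x < ∑ i ∈ Finset.range n, X i ω} ⊆
      (⋃ i ∈ Finset.range n, {ω | y < X i ω}) ∪ {ω | x ≤ (∑ i ∈ Finset.range n, Y i) ω} := by
    intro ω hω
    by_cases hc : ∃ i ∈ Finset.range n, y < X i ω
    · left
      simpa using hc
    · right
      push Not at hc
      have hω : x < ∑ i ∈ Finset.range n, X i ω := hω
      simp only [Set.mem_ofPred_eq, Finset.sum_apply]
      refine hω.le.trans (Finset.sum_le_sum fun i hi => ?_)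
      rw [hY]
      simp [hc i hi]
  have hbig : P.real (⋃ i ∈ Finset.range n, {ω | y < X i ω}) ≤ n * P.real {ω | y < X 0 ω} := by
    refine (measureReal_biUnion_finset_le _ _).trans (le_of_eq ?_)
    have : ∀ i ∈ Finset.range n, P.real {ω | y < X i ω} = P.real {ω | y < X 0 ω} := fun i _ => by
      rw [measureReal_def, measureReal_def]
      exact congrArg _ ((hident i).measure_mem_eq measurableSet_Ioi)
    rw [Finset.sum_congr rfl this]
    simp
  have hint : Integrable (fun ω => Real.exp (s * (∑ i ∈ Finset.range n, Y i) ω)) P := by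
    refine Integrable.of_bound (C := Real.exp (s * (n * y))) (by fun_prop)
      (Eventually.of_forall fun ω => ?_)
    rw [Real.norm_of_nonneg (Real.exp_pos _).le, Real.exp_le_exp, Finset.sum_apply]
    refine mul_le_mul_of_nonneg_left ?_ hs
    calc ∑ i ∈ Finset.range n, Y i ω ≤ ∑ i ∈ Finset.range n, y :=
          Finset.sum_le_sum fun i _ => min_le_right _ _
      _ = n * y := by simp
  have hmgf : mgf (∑ i ∈ Finset.range n, Y i) P s =
      (∫ ω, Real.exp (s * min (X 0 ω) y) ∂P) ^ n := by
    rw [hYindep.mgf_sum hYm]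
    have : ∀ i ∈ Finset.range n, mgf (Y i) P s = ∫ ω, Real.exp (s * min (X 0 ω) y) ∂P :=
      fun i _ => ((hident i).comp
        (u := fun u => Real.exp (s * min u y)) (by fun_prop)).integral_eq
    rw [Finset.prod_congr rfl this]
    simp
  calc P.real {ω | x < ∑ i ∈ Finset.range n, X i ω}
      ≤ P.real (⋃ i ∈ Finset.range n, {ω | y < X i ω}) +
        P.real {ω | x ≤ (∑ i ∈ Finset.range n, Y i) ω} :=
        (measureReal_mono hsubset).trans (measureReal_union_le _ _)
    _ ≤ _ := by
      have := measure_ge_le_exp_mul_mgf (μ := P) (X := ∑ i ∈ Finset.range n, Y i) x hs hint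
      rw [hmgf] at this
      exact add_le_add hbig this

/-- A Fuk–Nagaev type bound: uniformly in the number of summands, the sum exceeds its (slightly
enlarged) mean by `y` essentially only through one large summand. -/
theorem eventually_tail_sum_le (hXm : ∀ i, Measurable (X i)) (hindep : iIndepFun X P)
    (hident : ∀ i, IdentDistrib (X i) (X 0) P P) (hX : Integrable (X 0) P)
    (hh : IsConcaveScale h) (hsub : Tendsto (fun x => h x / x) atTop (nhds 0)) {r : ℝ}
    (hlog : ∀ᶠ x : ℝ in atTop, r * Real.log x ≤ h x)
    (htail : ∀ ε : ℝ, 0 < ε → ∀ᶠ x in atTop,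
      P.real {ω | x < X 0 ω} ≤ Real.exp (-((1 - ε) * h x)))
    {a η : ℝ} (ha0 : 0 < a) (ha1 : a < 1) (har : 1 < (1 - a) * r) (hη : 0 < η) :
    ∃ C : ℝ, 0 < C ∧ ∀ᶠ y in atTop, ∀ n : ℕ, 1 ≤ n →
      P.real {ω | n * ((∫ ω, X 0 ω ∂P) + η) + y < ∑ i ∈ Finset.range n, X i ω} ≤
        C * n * Real.exp (-((1 - a) * h y)) := by
  have hr : 0 < r := by
    by_contra hcon
    nlinarith
  obtain ⟨A, hA0, hA⟩ := exists_const_tail_le (c := 1 - a / 4) hh (by linarith)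
    (htail (a / 4) (by positivity))
  -- This is the surplus decay p(1-k) - q for p = 1 - a/4, k = a/4, q = 1 - a; it equals a/2 +
  -- a²/16.
  set e := (1 - a / 4) * (1 - a / 4) - (1 - a) with he
  have he0 : 0 < e := by rw [he]; nlinarith
  refine ⟨1 + A + Real.exp (A * (1 / e)), by positivity, ?_⟩
  filter_upwards [eventually_integral_exp_min_le (hXm 0) hX hh hsub (k := a / 4) (q := 1 - a)
    hlog (by positivity) (by linarith) (by linarith) (by nlinarith) (by linarith) hA0.le hA hη,
    eventually_gt_atTop 0] with y hy hy0 n hn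
  have hn1 : (1 : ℝ) ≤ n := by exact_mod_cast hn
  have hn0 : (0 : ℝ) < n := by linarith
  have hhy := hh.nonneg y hy0.le
  have hnq : (n : ℝ) * Real.exp (-((1 - a) * h y)) = Real.exp (-((1 - a) * h y - Real.log n)) := by
    rw [neg_sub, Real.exp_sub, Real.exp_log hn0, Real.exp_neg, div_eq_mul_inv]
  -- For log n ≥ (1-a)h(y) the claimed bound is at least 1; otherwise the tilt below is positive.
  rcases le_or_gt ((1 - a) * h y) (Real.log n) with hc | hc
  · have h1 : 1 ≤ (n : ℝ) * Real.exp (-((1 - a) * h y)) := by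
      rw [hnq, Real.one_le_exp_iff]; linarith
    have h2 : 1 ≤ 1 + A + Real.exp (A * (1 / e)) := by
      linarith [Real.exp_pos (A * (1 / e))]
    rw [mul_assoc]
    exact measureReal_le_one.trans (one_le_mul_of_one_le_of_one_le h2 h1)
  · set m := ∫ ω, X 0 ω ∂P
    set s := ((1 - a) * h y - Real.log n) / y with hs
    have hs0 : 0 < s := div_pos (by linarith) hy0
    have hsy : s * y = (1 - a) * h y - Real.log n := div_mul_cancel₀ _ hy0.ne'
    have hM := hy (Real.log n) s (Real.log_nonneg hn1) hs0 hsy.le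
    rw [← he] at hM
    set D := A * Real.exp (-(Real.log n + e * h y)) with hD
    -- The choice b = log n gives D a factor 1/n, cancelling the n summands; the surplus e then
    -- absorbs sy ≤ h(y).
    have hnD : n * D * (s * y) ≤ A * (1 / e) := by
      have h1 : n * D = A * Real.exp (-(e * h y)) := by
        rw [hD, neg_add, Real.exp_add, Real.exp_neg (Real.log n), Real.exp_log hn0]
        field_simp
      have h2 : s * y ≤ h y := by
        rw [hsy]
        nlinarith [Real.log_nonneg hn1]
      calc n * D * (s * y) = A * (s * y * Real.exp (-(e * h y))) := by rw [h1]; ring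
        _ ≤ A * (h y * Real.exp (-(e * h y))) := by gcongr
        _ ≤ A * (1 / e) := by gcongr; exact mul_exp_neg_mul_le he0
    have hMn : (∫ ω, Real.exp (s * min (X 0 ω) y) ∂P) ^ n ≤
        Real.exp (n * (s * (m + η + D * y))) := by
      rw [Real.exp_nat_mul]
      refine pow_le_pow_left₀ (integral_nonneg fun ω => (Real.exp_pos _).le) (hM.trans ?_) n
      linarith [Real.add_one_le_exp (s * (m + η + D * y))]
    have hjump : P.real {ω | y < X 0 ω} ≤ A * Real.exp (-((1 - a) * h y)) := by
      refine (hA y hy0.le).trans ?_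
      gcongr
      linarith
    refine (tail_sum_le_of_mgf hXm hindep hident hs0.le _ y n).trans ?_
    calc n * P.real {ω | y < X 0 ω} + Real.exp (-s * (n * (m + η) + y)) *
          (∫ ω, Real.exp (s * min (X 0 ω) y) ∂P) ^ n
        ≤ n * (A * Real.exp (-((1 - a) * h y))) + Real.exp (-s * (n * (m + η) + y)) *
          Real.exp (n * (s * (m + η + D * y))) := by gcongr
      _ = n * (A * Real.exp (-((1 - a) * h y))) + Real.exp (-(s * y)) *
          Real.exp (n * D * (s * y)) := by
        rw [← Real.exp_add, ← Real.exp_add]; ring_nf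
      _ ≤ n * (A * Real.exp (-((1 - a) * h y))) + Real.exp (-(s * y)) *
          Real.exp (A * (1 / e)) := by gcongr
      _ = (A + Real.exp (A * (1 / e))) * (n * Real.exp (-((1 - a) * h y))) := by
        rw [hsy, ← hnq]; ring
      _ ≤ (1 + A + Real.exp (A * (1 / e))) * (n * Real.exp (-((1 - a) * h y))) := by
        gcongr; linarith
      _ = _ := by ring

end Sums

/-! ### Upper tail bound for the stopped sum -/

section StoppedSum

variable {Ω : Type*} [MeasurableSpace Ω] {P : Measure Ω} {X : ℕ → Ω → ℝ} {N : Ω → ℕ}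

theorem measurable_stoppedSum (hXm : ∀ i, Measurable (X i)) (hNm : Measurable N) :
    Measurable (stoppedSum X N) := by
  have h1 : Measurable fun p : ℕ × Ω => ∑ i ∈ Finset.range p.1, X i p.2 :=
    measurable_from_prod_countable_right fun n =>
      Finset.measurable_sum (Finset.range n) fun i _ => hXm i
  exact h1.comp (hNm.prodMk measurable_id)

theorem measure_lt_stoppedSum (hXm : ∀ i, Measurable (X i)) (hNm : Measurable N)
    (hind : IndepFun N (fun ω i => X i ω) P) (x : ℝ) :
    P {ω | x < stoppedSum X N ω} =
      ∫⁻ ω, P {ω' | x < ∑ i ∈ Finset.range (N ω), X i ω'} ∂P := by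
  have hSm : ∀ n : ℕ, Measurable fun ω => ∑ i ∈ Finset.range n, X i ω := fun n =>
    Finset.measurable_sum _ fun i _ => hXm i
  have hset : {ω | x < stoppedSum X N ω} =
      ⋃ n : ℕ, (N ⁻¹' {n} ∩ {ω | x < ∑ i ∈ Finset.range n, X i ω}) := by
    ext ω
    simp [stoppedSum]
  rw [hset, measure_iUnion]
  · rw [← lintegral_map (f := fun n : ℕ => P {ω' | x < ∑ i ∈ Finset.range n, X i ω'})
      (measurable_of_countable _) hNm, lintegral_countable']
    refine tsum_congr fun n => ?_
    have hB : MeasurableSet {f : ℕ → ℝ | x < ∑ i ∈ Finset.range n, f i} :=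
      measurableSet_lt measurable_const
        (Finset.measurable_sum _ fun i _ => measurable_pi_apply i)
    have := hind.measure_inter_preimage_eq_mul {n} _ (measurableSet_singleton n) hB
    rw [Measure.map_apply hNm (measurableSet_singleton n), mul_comm]
    exact this
  · intro i j hij
    refine Set.disjoint_left.2 fun ω h1 h2 => hij ?_
    exact h1.1.symm.trans h2.1
  · exact fun n => (hNm (measurableSet_singleton n)).inter
      (measurableSet_lt measurable_const (hSm n))

theorem measureReal_lt_stoppedSum [IsProbabilityMeasure P] (hXm : ∀ i, Measurable (X i))
    (hNm : Measurable N) (hind : IndepFun N (fun ω i => X i ω) P) (x : ℝ) :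
    P.real {ω | x < stoppedSum X N ω} =
      ∫ ω, P.real {ω' | x < ∑ i ∈ Finset.range (N ω), X i ω'} ∂P := by
  rw [measureReal_def, measure_lt_stoppedSum hXm hNm hind]
  refine (integral_toReal ?_ ?_).symm
  · exact ((measurable_of_countable
      (fun n : ℕ => P {ω' | x < ∑ i ∈ Finset.range n, X i ω'})).comp hNm).aemeasurable
  · exact Eventually.of_forall fun ω => measure_lt_top _ _

theorem exists_pow_four_ge_and_lt {ε r : ℝ} (hε : 0 < ε) (hr : 1 < r) :
    ∃ a : ℝ, 0 < a ∧ a < 1 ∧ 1 - ε ≤ (1 - a) ^ 4 ∧ 1 < (1 - a) ^ 2 * r := by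
  have h1 : Tendsto (fun a : ℝ => (1 - a) ^ 4) (nhdsWithin 0 (Set.Ioi 0)) (nhds 1) := by
    have : Continuous fun a : ℝ => (1 - a) ^ 4 := by fun_prop
    simpa using (this.tendsto 0).mono_left nhdsWithin_le_nhds
  have h2 : Tendsto (fun a : ℝ => (1 - a) ^ 2 * r) (nhdsWithin 0 (Set.Ioi 0)) (nhds r) := by
    have : Continuous fun a : ℝ => (1 - a) ^ 2 * r := by fun_prop
    simpa using (this.tendsto 0).mono_left nhdsWithin_le_nhds
  have h3 : ∀ᶠ a : ℝ in nhdsWithin 0 (Set.Ioi 0), a < 1 :=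
    nhdsWithin_le_nhds (eventually_lt_nhds one_pos)
  obtain ⟨a, h4, h5, h6, h7⟩ := ((h1.eventually_const_lt (show 1 - ε < 1 by linarith)).and
    ((h2.eventually_const_lt hr).and (h3.and self_mem_nhdsWithin))).exists
  exact ⟨a, h7, h6, h4.le, h5⟩

theorem eventually_exp_add_le {b c d K : ℝ} (hb : d < b) (hc : d < c) :
    ∀ᶠ u : ℝ in atTop, Real.exp (-(b * u)) + K * (1 + u) * Real.exp (-(c * u)) ≤
      Real.exp (-(d * u)) := by
  have hd0 : 0 < c - d := by linarith
  have h1 : Tendsto (fun u : ℝ => Real.exp (-((b - d) * u))) atTop (nhds 0) :=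
    Real.tendsto_exp_neg_atTop_nhds_zero.comp (tendsto_id.const_mul_atTop (by linarith))
  have h2 : Tendsto (fun u : ℝ => Real.exp (-((c - d) * u))) atTop (nhds 0) :=
    Real.tendsto_exp_neg_atTop_nhds_zero.comp (tendsto_id.const_mul_atTop hd0)
  have h3 : Tendsto (fun u : ℝ => u * Real.exp (-((c - d) * u))) atTop (nhds 0) := by
    have := ((Real.tendsto_pow_mul_exp_neg_atTop_nhds_zero 1).comp
      (tendsto_id.const_mul_atTop hd0)).const_mul (1 / (c - d))
    rw [mul_zero] at this
    refine this.congr fun u => ?_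
    simp only [Function.comp, id, pow_one]
    field_simp
  have h4 := h1.add ((h2.add h3).const_mul K)
  simp only [add_zero, mul_zero] at h4
  filter_upwards [h4.eventually_lt_const one_pos] with u hu
  have e1 : Real.exp (-(b * u)) = Real.exp (-((b - d) * u)) * Real.exp (-(d * u)) := by
    rw [← Real.exp_add]; ring_nf
  have e2 : Real.exp (-(c * u)) = Real.exp (-((c - d) * u)) * Real.exp (-(d * u)) := by
    rw [← Real.exp_add]; ring_nf
  rw [e1, e2]
  have := mul_le_mul_of_nonneg_right hu.le (Real.exp_pos (-(d * u))).le
  linarith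

/-- Trades the factor z, which comes from the number of summands, for (exp(sz) - 1)/s, whose
truncated mean stays bounded as s → 0; the price is only 1 + sz. -/
theorem mul_exp_mul_le {s z : ℝ} (hs : 0 < s) :
    z * Real.exp (s * z) ≤ (1 + s * z) * ((Real.exp (s * z) - 1) / s) := by
  rw [mul_div_assoc', le_div_iff₀ hs]
  nlinarith [Real.add_one_le_exp (s * z)]

/-- Apply the chord inequality at x - z between a(x - z) and x. The term at a(x - z) is at least log
x, which leaves exactly the tilt admissible with b = log x. -/
theorem IsConcaveScale.exp_neg_sub_le {h : ℝ → ℝ} (hh : IsConcaveScale h) {a x z : ℝ}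
    (ha0 : 0 < a) (ha1 : a < 1) (hx : 0 < x) (hz : 0 ≤ z) (hzx : z ≤ (1 - a) * x)
    (hlog : Real.log x ≤ (1 - a) * h (a ^ 2 * x)) :
    Real.exp (-((1 - a) * h (x - z))) ≤ Real.exp (-((1 - a) ^ 2 * h x)) *
      Real.exp (((1 - a) ^ 2 * h x - Real.log x) / x * z) := by
  rw [← Real.exp_add, Real.exp_le_exp]
  have hv : a * x ≤ x - z := by linarith
  have hv0 : 0 < x - z := lt_of_lt_of_le (by positivity) hv
  have hch := hh.chord_le ha0 ha1 hv0 (show x - z ≤ x by linarith)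
  have hr : (x - z) / x = 1 - z / x := by field_simp
  rw [hr] at hch
  have hzx0 : 0 ≤ z / x := by positivity
  have hm : h (a ^ 2 * x) ≤ h (a * (x - z)) :=
    hh.mono (by positivity) (by nlinarith)
  have h1 : Real.log x ≤ (1 - a) * h (a * (x - z)) :=
    hlog.trans (mul_le_mul_of_nonneg_left hm (by linarith))
  have h2 := mul_le_mul_of_nonneg_left h1 hzx0
  have h3 := mul_le_mul_of_nonneg_left hch (show 0 ≤ 1 - a by linarith)
  have h4 : ((1 - a) ^ 2 * h x - Real.log x) / x * z =
      z / x * ((1 - a) ^ 2 * h x - Real.log x) := by ring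
  rw [h4]
  nlinarith

-- Condition on N and put Z = cN with c slightly above the mean. The event Z > βx is estimated by
-- the tail of N; elsewhere the Fuk–Nagaev bound at x - Z ≥ ax is integrated against the law of Z.
-- Four factors β = 1 - a are available, since β⁴ ≥ 1 - ε.
set_option maxHeartbeats 400000 in
theorem eventually_tail_stoppedSum_le [IsProbabilityMeasure P] (hXm : ∀ i, Measurable (X i))
    (hNm : Measurable N) (hNpos : ∀ ω, 1 ≤ N ω) (hindep : iIndepFun X P)
    (hident : ∀ i, IdentDistrib (X i) (X 0) P P) (hNind : IndepFun N (fun ω i => X i ω) P)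
    (hX : Integrable (X 0) P) (hmean : 0 < ∫ ω, X 0 ω ∂P) {h : ℝ → ℝ}
    (hh : IsConcaveScale h) (hsub : Tendsto (fun x => h x / x) atTop (nhds 0)) {r : ℝ} (hr : 1 < r)
    (hlog : ∀ᶠ x : ℝ in atTop, r * Real.log x ≤ h x)
    (htailX : ∀ ε : ℝ, 0 < ε → ∀ᶠ x in atTop,
      P.real {ω | x < X 0 ω} ≤ Real.exp (-((1 - ε) * h x)))
    (htailN : ∀ ε : ℝ, 0 < ε → ∀ᶠ x in atTop,
      P.real {ω | x < (∫ ω', X 0 ω' ∂P) * N ω} ≤ Real.exp (-((1 - ε) * h x)))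
    {ε : ℝ} (hε : 0 < ε) :
    ∀ᶠ x in atTop, P.real {ω | x < stoppedSum X N ω} ≤ Real.exp (-((1 - ε) * h x)) := by
  set m := ∫ ω, X 0 ω ∂P with hm
  obtain ⟨a, ha0, ha1, haε, har⟩ := exists_pow_four_ge_and_lt hε hr
  set β := 1 - a with hβ
  have hβ0 : 0 < β := by linarith
  have hβ1 : β < 1 := by linarith
  have hβr : 1 < β * r := by nlinarith
  set c := m / β with hc
  have hc0 : 0 < c := by positivity
  have hη : 0 < c - m := by
    have : c * β = m := by rw [hc]; field_simp
    nlinarith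
  obtain ⟨C, hC0, hFN⟩ := eventually_tail_sum_le hXm hindep hident hX hh hsub hlog htailX
    ha0 ha1 hβr hη
  rw [← hm, add_sub_cancel] at hFN
  set Z : Ω → ℝ := fun ω => c * N ω with hZ
  have hZm : Measurable Z := ((measurable_of_countable (fun n : ℕ => (n : ℝ))).comp hNm).const_mul c
  have hZ0 : ∀ ω, 0 ≤ Z ω := fun ω => by positivity
  obtain ⟨A, hA0, hA⟩ := exists_const_tail_le (c := 1 - a / 4) hh (by linarith)
    (htailN (a / 4) (by positivity))
  have hZset : ∀ x, {ω | x < Z ω} = {ω | β * x < m * N ω} := fun x => by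
    ext ω
    simp only [Set.mem_ofPred_eq, hZ, hc]
    rw [div_mul_eq_mul_div, lt_div_iff₀ hβ0, mul_comm]
  have hZA : ∀ x, 0 ≤ x → P.real {ω | x < Z ω} ≤ A * Real.exp (-(β * (1 - a / 4) * h x)) := by
    intro x hx
    rw [hZset]
    refine (hA _ (by positivity)).trans ?_
    refine mul_le_mul_of_nonneg_left (Real.exp_le_exp.2 (neg_le_neg ?_)) hA0.le
    have := mul_le_mul_of_nonneg_left (hh.mul_le hβ0.le hβ1.le hx)
      (show 0 ≤ 1 - a / 4 by linarith)
    linarith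
  have hpr : 1 < β * (1 - a / 4) * r := by nlinarith
  have hp0 : 0 < β * (1 - a / 4) := mul_pos hβ0 (by linarith)
  have hZint := integrable_of_tail_le hZm hZ0 hh hlog hp0 hpr hA0.le hZA
  have hE := eventually_integral_exp_min_le hZm hZint hh hsub (k := a / 4) (q := β ^ 2) hlog
    (by positivity) (by linarith) hp0 hpr (by nlinarith) hA0.le hZA one_pos
  -- With b = log x the truncation error D x is at most A, so M bounds (E exp(s min(Z, x)) - 1)/s
  -- uniformly in x.
  set M := (∫ ω, Z ω ∂P) + 1 + A with hM
  have hlog2 : ∀ᶠ x : ℝ in atTop, Real.log x ≤ β * h (a ^ 2 * x) := by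
    have h1 : ∀ᶠ x : ℝ in atTop, -(β * r * Real.log (a ^ 2)) / (β * r - 1) ≤ Real.log x :=
      Real.tendsto_log_atTop.eventually_ge_atTop _
    filter_upwards [h1, (tendsto_id.const_mul_atTop (pow_pos ha0 2)).eventually hlog,
      eventually_gt_atTop 0] with x h2 h3 h4
    simp only [id] at h3
    rw [Real.log_mul (by positivity) h4.ne'] at h3
    rw [div_le_iff₀ (by linarith)] at h2
    nlinarith [mul_le_mul_of_nonneg_left h3 hβ0.le]
  -- The polynomial factor 1 + h(x) and all constants are absorbed by lowering the exponents β³ and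
  -- β² to β⁴.
  have hfin := hh.tendsto_atTop.eventually
    (eventually_exp_add_le (b := β ^ 3) (c := β ^ 2) (d := β ^ 4) (K := C / c * M)
      (pow_lt_pow_right_of_lt_one₀ hβ0 hβ1 (by norm_num))
      (pow_lt_pow_right_of_lt_one₀ hβ0 hβ1 (by norm_num)))
  have hNt := (tendsto_id.const_mul_atTop (mul_pos hβ0 hβ0)).eventually (htailN a ha0)
  obtain ⟨y₀, hy₀⟩ := eventually_atTop.1 hFN
  filter_upwards [hE, hlog2, hfin, hNt, hlog, eventually_gt_atTop 1,
    eventually_ge_atTop (y₀ / a)] with x hE hlog2 hfin hNt hlog hx1 hxy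
  have hx0 : 0 < x := by linarith
  have hlogx : 0 < Real.log x := Real.log_pos hx1
  have hhx := hh.nonneg x hx0.le
  rw [div_le_iff₀ ha0] at hxy
  set s := (β ^ 2 * h x - Real.log x) / x with hs
  have hs0 : 0 < s := by
    refine div_pos ?_ hx0
    have : β ^ 2 * (r * Real.log x) ≤ β ^ 2 * h x := by gcongr
    nlinarith
  have hsx : s * x = β ^ 2 * h x - Real.log x := div_mul_cancel₀ _ hx0.ne'
  have hEx : (∫ ω, Real.exp (s * min (Z ω) x) ∂P) ≤ 1 + s * M := by
    refine (hE (Real.log x) s hlogx.le hs0 hsx.le).trans ?_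
    have h1 : Real.exp (-(Real.log x + (β * (1 - a / 4) * (1 - a / 4) - β ^ 2) * h x)) * x ≤ 1 := by
      rw [neg_add, Real.exp_add, Real.exp_neg (Real.log x), Real.exp_log hx0]
      have h2 : Real.exp (-((β * (1 - a / 4) * (1 - a / 4) - β ^ 2) * h x)) ≤ 1 := by
        rw [Real.exp_le_one_iff, neg_nonpos]
        refine mul_nonneg ?_ hhx
        have : β * (1 - a / 4) * (1 - a / 4) - β ^ 2 = β * (a / 2 + a ^ 2 / 16) := by
          rw [hβ]; ring
        rw [this]; positivity
      calc _ = Real.exp (-((β * (1 - a / 4) * (1 - a / 4) - β ^ 2) * h x)) := by field_simp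
        _ ≤ 1 := h2
    have h2 := mul_le_mul_of_nonneg_left h1 hA0.le
    rw [hM]
    gcongr
    linarith
  have hpt : ∀ ω, P.real {ω' | x < ∑ i ∈ Finset.range (N ω), X i ω'} ≤
      Set.indicator {ω | β * x < Z ω} (fun _ => (1 : ℝ)) ω +
        C / c * (1 + h x) * Real.exp (-(β ^ 2 * h x)) *
          ((Real.exp (s * min (Z ω) x) - 1) / s) := by
    intro ω
    have hmin0 : 0 ≤ min (Z ω) x := le_min (hZ0 ω) hx0.le
    have hnn : 0 ≤ (Real.exp (s * min (Z ω) x) - 1) / s := by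
      refine div_nonneg ?_ hs0.le
      linarith [Real.one_le_exp (mul_nonneg hs0.le hmin0)]
    by_cases hω : β * x < Z ω
    · rw [Set.indicator_of_mem (show ω ∈ {ω | β * x < Z ω} from hω)]
      refine measureReal_le_one.trans (le_add_of_nonneg_right ?_)
      positivity
    · rw [Set.indicator_of_notMem (show ω ∉ {ω | β * x < Z ω} from hω), zero_add]
      have hω : Z ω ≤ β * x := not_lt.1 hω
      have hZω : Z ω = c * N ω := rfl
      have hZx : Z ω ≤ x := hω.trans (mul_le_of_le_one_left hx0.le hβ1.le)
      rw [min_eq_left hZx] at hnn ⊢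
      have h1 := hy₀ (x - Z ω) (by rw [hβ] at hω; linarith) (N ω) (hNpos ω)
      have h2 : (N ω : ℝ) * c + (x - Z ω) = x := by rw [hZω]; ring
      rw [h2] at h1
      have h3 := hh.exp_neg_sub_le ha0 ha1 hx0 (hZ0 ω) hω hlog2
      have h4 := mul_exp_mul_le (z := Z ω) hs0
      have h5 : s * Z ω ≤ h x := by
        have := mul_le_mul_of_nonneg_left hZx hs0.le
        have : β ^ 2 * h x ≤ h x := mul_le_of_le_one_left hhx (pow_le_one₀ hβ0.le hβ1.le)
        linarith
      calc _ ≤ C * N ω * Real.exp (-(β * h (x - Z ω))) := h1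
        _ ≤ C * N ω * (Real.exp (-(β ^ 2 * h x)) * Real.exp (s * Z ω)) := by gcongr
        _ = C / c * Real.exp (-(β ^ 2 * h x)) * (Z ω * Real.exp (s * Z ω)) := by
          rw [hZω]; field_simp
        _ ≤ C / c * Real.exp (-(β ^ 2 * h x)) *
            ((1 + h x) * ((Real.exp (s * Z ω) - 1) / s)) :=
          mul_le_mul_of_nonneg_left (h4.trans (mul_le_mul_of_nonneg_right (by linarith) hnn))
            (by positivity)
        _ = _ := by ring
  have hexpint : Integrable (fun ω => Real.exp (s * min (Z ω) x)) P := by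
    refine Integrable.of_bound (C := Real.exp (s * x)) (by fun_prop)
      (Eventually.of_forall fun ω => ?_)
    rw [Real.norm_of_nonneg (Real.exp_pos _).le]
    exact Real.exp_le_exp.2 (mul_le_mul_of_nonneg_left (min_le_right _ _) hs0.le)
  have hSet : MeasurableSet {ω | β * x < Z ω} := measurableSet_lt measurable_const hZm
  have i1 : Integrable (Set.indicator {ω | β * x < Z ω} (fun _ => (1 : ℝ))) P :=
    (integrable_const 1).indicator hSet
  have i2 : Integrable (fun ω => C / c * (1 + h x) * Real.exp (-(β ^ 2 * h x)) *
      ((Real.exp (s * min (Z ω) x) - 1) / s)) P :=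
    ((hexpint.sub (integrable_const 1)).div_const s).const_mul _
  have hfirst : P.real {ω | β * x < Z ω} ≤ Real.exp (-(β ^ 3 * h x)) := by
    rw [hZset, ← mul_assoc]
    refine hNt.trans ?_
    rw [Real.exp_le_exp, neg_le_neg_iff]
    have := hh.mul_le (mul_pos hβ0 hβ0).le (by nlinarith : β * β ≤ 1) hx0.le
    have := mul_le_mul_of_nonneg_left this hβ0.le
    simp only [id]
    nlinarith
  calc P.real {ω | x < stoppedSum X N ω}
      = ∫ ω, P.real {ω' | x < ∑ i ∈ Finset.range (N ω), X i ω'} ∂P :=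
        measureReal_lt_stoppedSum hXm hNm hNind x
    _ ≤ ∫ ω, (Set.indicator {ω | β * x < Z ω} (fun _ => (1 : ℝ)) ω +
        C / c * (1 + h x) * Real.exp (-(β ^ 2 * h x)) *
          ((Real.exp (s * min (Z ω) x) - 1) / s)) ∂P :=
        integral_mono_of_nonneg (Eventually.of_forall fun _ => measureReal_nonneg) (i1.add i2)
          (Eventually.of_forall hpt)
    _ = P.real {ω | β * x < Z ω} + C / c * (1 + h x) * Real.exp (-(β ^ 2 * h x)) *
        (((∫ ω, Real.exp (s * min (Z ω) x) ∂P) - 1) / s) := by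
        rw [integral_add i1 i2, integral_const_mul, integral_div,
          integral_sub hexpint (integrable_const 1), integral_indicator_const _ hSet]
        simp
    _ ≤ Real.exp (-(β ^ 3 * h x)) + C / c * (1 + h x) * Real.exp (-(β ^ 2 * h x)) * M := by
        have : ((∫ ω, Real.exp (s * min (Z ω) x) ∂P) - 1) / s ≤ M := by
          rw [div_le_iff₀ hs0]; linarith
        gcongr
    _ = Real.exp (-(β ^ 3 * h x)) + C / c * M * (1 + h x) * Real.exp (-(β ^ 2 * h x)) := by ring
    _ ≤ Real.exp (-(β ^ 4 * h x)) := hfin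
    _ ≤ Real.exp (-((1 - ε) * h x)) := by gcongr

end StoppedSum

/-! ### Lower tail bounds: one large summand, or many summands -/

section LowerBounds

variable {Ω : Type*} [MeasurableSpace Ω] {P : Measure Ω} [IsProbabilityMeasure P]
  {X : ℕ → Ω → ℝ} {N : Ω → ℕ}

theorem exists_mul_tail_le_tail_stoppedSum (hNpos : ∀ ω, 1 ≤ N ω) (hindep : iIndepFun X P)
    (hident : ∀ i, IdentDistrib (X i) (X 0) P P) (hNind : IndepFun N (fun ω i => X i ω) P) :
    ∃ c K : ℝ, 0 < c ∧ 0 ≤ K ∧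
      ∀ x, c * P.real {ω | x + K < X 0 ω} ≤ P.real {ω | x < stoppedSum X N ω} := by
  have huniv : P Set.univ ≠ 0 := by simp
  obtain ⟨n, hn⟩ : ∃ n : ℕ, 0 < P (N ⁻¹' {n}) := by
    refine exists_measure_pos_of_not_measure_iUnion_null (s := fun n : ℕ => N ⁻¹' {n}) ?_
    convert huniv
    ext ω; simp
  obtain ⟨k, hk⟩ : ∃ k : ℕ, 0 < P {ω | -(k : ℝ) < X 0 ω} := by
    refine exists_measure_pos_of_not_measure_iUnion_null
      (s := fun k : ℕ => {ω | -(k : ℝ) < X 0 ω}) ?_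
    convert huniv
    ext ω
    obtain ⟨k, hk⟩ := exists_nat_gt (-X 0 ω)
    simp only [Set.mem_iUnion, Set.mem_ofPred_eq, Set.mem_univ, iff_true]
    exact ⟨k, by linarith⟩
  obtain ⟨n, rfl⟩ : ∃ l, n = l + 1 := by
    refine Nat.exists_eq_succ_of_ne_zero fun h0 => ?_
    have : N ⁻¹' {n} = ∅ := by
      ext ω
      have := hNpos ω
      simp only [Set.mem_preimage, Set.mem_singleton_iff, Set.mem_empty_iff_false, iff_false]
      omega
    simp [this] at hn
  have hn' : 0 < P.real (N ⁻¹' {n + 1}) := ENNReal.toReal_pos hn.ne' (measure_ne_top _ _)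
  have hk' : 0 < P.real {ω | -(k : ℝ) < X 0 ω} := ENNReal.toReal_pos hk.ne' (measure_ne_top _ _)
  refine ⟨P.real (N ⁻¹' {n + 1}) * P.real {ω | -(k : ℝ) < X 0 ω} ^ n, n * k, by positivity,
    by positivity, fun x => ?_⟩
  -- Index 0 carries the large jump; the remaining n summands exceed -k, hence the margin n * k.
  set B : ℕ → Set ℝ := fun i => if i = 0 then Set.Ioi (x + n * k) else Set.Ioi (-(k : ℝ)) with hB
  have hBm : ∀ i, MeasurableSet (B i) := fun i => by
    rw [hB]; dsimp only; split_ifs <;> exact measurableSet_Ioi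
  have hprod := hindep.measure_inter_preimage_eq_mul (Finset.range (n + 1)) (sets := B)
    (fun i _ => hBm i)
  have hT : MeasurableSet {f : ℕ → ℝ | x < ∑ i ∈ Finset.range (n + 1), f i} :=
    measurableSet_lt measurable_const (Finset.measurable_sum _ fun i _ => measurable_pi_apply i)
  have hNprod := hNind.measure_inter_preimage_eq_mul {n + 1} _ (measurableSet_singleton _) hT
  have h1 : P (⋂ i ∈ Finset.range (n + 1), X i ⁻¹' B i) ≤
      P ((fun ω i => X i ω) ⁻¹' {f : ℕ → ℝ | x < ∑ i ∈ Finset.range (n + 1), f i}) := by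
    refine measure_mono fun ω hω => ?_
    simp only [Set.mem_iInter, Finset.mem_range, Set.mem_preimage] at hω
    have h0 : x + n * k < X 0 ω := by simpa [hB] using hω 0 (by omega)
    have hi : ∀ i ∈ Finset.range n, -(k : ℝ) ≤ X (i + 1) ω := fun i hi => by
      have := hω (i + 1) (by simpa using hi)
      simp only [hB, Nat.add_eq_zero_iff, one_ne_zero, and_false, if_false, Set.mem_Ioi] at this
      exact this.le
    have hsum := Finset.sum_le_sum hi
    simp only [Finset.sum_const, Finset.card_range, nsmul_eq_mul] at hsum
    simp only [Set.mem_preimage, Set.mem_ofPred_eq, Finset.sum_range_succ']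
    linarith
  have h2 : P (N ⁻¹' {n + 1} ∩
      (fun ω i => X i ω) ⁻¹' {f : ℕ → ℝ | x < ∑ i ∈ Finset.range (n + 1), f i}) ≤
      P {ω | x < stoppedSum X N ω} := by
    refine measure_mono fun ω hω => ?_
    have hN : N ω = n + 1 := hω.1
    have : x < ∑ i ∈ Finset.range (n + 1), X i ω := hω.2
    simpa [stoppedSum, hN] using this
  have h3 : P (⋂ i ∈ Finset.range (n + 1), X i ⁻¹' B i) =
      P {ω | -(k : ℝ) < X 0 ω} ^ n * P {ω | x + n * k < X 0 ω} := by
    rw [hprod, Finset.prod_range_succ']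
    have : ∀ i ∈ Finset.range n, P (X (i + 1) ⁻¹' B (i + 1)) = P {ω | -(k : ℝ) < X 0 ω} :=
      fun i _ => by
        have := (hident (i + 1)).measure_mem_eq (s := Set.Ioi (-(k : ℝ))) measurableSet_Ioi
        simp only [hB, Nat.add_eq_zero_iff, one_ne_zero, and_false, if_false]
        exact this
    rw [Finset.prod_congr rfl this]
    simp only [Finset.prod_const, Finset.card_range, hB, if_true]
    rfl
  rw [hNprod] at h2
  rw [h3] at h1
  have h4 := (mul_le_mul_right h1 (P (N ⁻¹' {n + 1}))).trans h2
  have h5 := ENNReal.toReal_mono (measure_ne_top _ _) h4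
  simp only [ENNReal.toReal_mul, ENNReal.toReal_pow] at h5
  simp only [measureReal_def]
  linarith

theorem exists_half_le_tail_sum (hXm : ∀ i, Measurable (X i)) (hindep : iIndepFun X P)
    (hident : ∀ i, IdentDistrib (X i) (X 0) P P) (hX : Integrable (X 0) P) {c : ℝ}
    (hc : c < ∫ ω, X 0 ω ∂P) :
    ∃ n₀ : ℕ, ∀ n, n₀ ≤ n → 1 / 2 ≤ P.real {ω | c * n < ∑ i ∈ Finset.range n, X i ω} := by
  set m := ∫ ω, X 0 ω ∂P
  have hSm : ∀ n : ℕ, Measurable fun ω => ∑ i ∈ Finset.range n, X i ω := fun n =>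
    Finset.measurable_sum _ fun i _ => hXm i
  have hlln := strong_law_ae_real X hX (fun i j hij => hindep.indepFun hij) hident
  have hmeas := tendstoInMeasure_of_tendsto_ae (g := fun _ => m)
    (fun n => ((hSm n).div_const (n : ℝ)).aestronglyMeasurable) hlln
  rw [tendstoInMeasure_iff_measureReal_dist] at hmeas
  have := (hmeas (m - c) (by linarith)).eventually_lt_const (show (0 : ℝ) < 1 / 2 by norm_num)
  obtain ⟨n₀, hn₀⟩ := eventually_atTop.1 (this.and (eventually_gt_atTop 0))
  refine ⟨n₀, fun n hn => ?_⟩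
  obtain ⟨h1, h2⟩ := hn₀ n hn
  have h2 : (0 : ℝ) < n := by exact_mod_cast h2
  have hcompl := probReal_compl_eq_one_sub (μ := P)
    (measurableSet_lt (measurable_const (a := c * n)) (hSm n))
  have hsub : P.real {ω | c * n < ∑ i ∈ Finset.range n, X i ω}ᶜ ≤
      P.real {ω | m - c ≤ dist ((∑ i ∈ Finset.range n, X i ω) / n) m} := by
    refine measureReal_mono fun ω hω => ?_
    have hω : ∑ i ∈ Finset.range n, X i ω ≤ c * n := not_lt.1 hω
    have h3 := (div_le_iff₀ h2).2 hω
    simp only [Set.mem_ofPred_eq]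
    rw [dist_comm, Real.dist_eq]
    exact le_trans (by linarith) (le_abs_self _)
  linarith

/-- If cN > x with x large, then N is large too, and the law of large numbers gives S_N > cN > x
with conditional probability at least 1/2. -/
theorem eventually_half_mul_tail_le_tail_stoppedSum (hXm : ∀ i, Measurable (X i))
    (hNm : Measurable N) (hindep : iIndepFun X P)
    (hident : ∀ i, IdentDistrib (X i) (X 0) P P) (hNind : IndepFun N (fun ω i => X i ω) P)
    (hX : Integrable (X 0) P) {c : ℝ} (hc0 : 0 < c) (hc : c < ∫ ω, X 0 ω ∂P) :
    ∀ᶠ x in atTop, 1 / 2 * P.real {ω | x < c * N ω} ≤ P.real {ω | x < stoppedSum X N ω} := by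
  obtain ⟨n₀, hn₀⟩ := exists_half_le_tail_sum hXm hindep hident hX hc
  filter_upwards [eventually_ge_atTop (c * n₀)] with x hx
  have hset : MeasurableSet {ω | x < c * N ω} := measurableSet_lt measurable_const
    (((measurable_of_countable (fun n : ℕ => (n : ℝ))).comp hNm).const_mul c)
  have h1 : 1 / 2 * P.real {ω | x < c * N ω} =
      ∫ ω, Set.indicator {ω | x < c * N ω} (fun _ => (1 / 2 : ℝ)) ω ∂P := by
    rw [integral_indicator_const _ hset, smul_eq_mul, mul_comm]
  rw [measureReal_lt_stoppedSum hXm hNm hNind, h1]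
  refine integral_mono_of_nonneg (Eventually.of_forall fun ω =>
    Set.indicator_nonneg (fun _ _ => by norm_num) _) ?_ (Eventually.of_forall fun ω => ?_)
  · refine Integrable.of_bound (C := 1) ?_ (Eventually.of_forall fun ω => ?_)
    · exact ((measurable_of_countable
        (fun n : ℕ => P.real {ω' | x < ∑ i ∈ Finset.range n, X i ω'})).comp
          hNm).aestronglyMeasurable
    · rw [Real.norm_of_nonneg measureReal_nonneg]
      exact measureReal_le_one
  · dsimp only
    by_cases hω : x < c * N ω
    · rw [Set.indicator_of_mem (show ω ∈ {ω | x < c * N ω} from hω)]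
      have hle : n₀ ≤ N ω := by
        have : c * (n₀ : ℝ) < c * N ω := hx.trans_lt hω
        exact_mod_cast (lt_of_mul_lt_mul_left this hc0.le).le
      refine (hn₀ _ hle).trans (measureReal_mono fun ω' hω' => ?_)
      exact hω.trans hω'
    · rw [Set.indicator_of_notMem (show ω ∉ {ω | x < c * N ω} from hω)]
      exact measureReal_nonneg

end LowerBounds

/-! ### Transfer of bounds between tails and between scales -/

section Comparison

/-- Concavity gives h((1+e)x) ≤ (1+e)h(x), so a small dilation costs only a factor 1 + e in the
exponent, and the constant c is absorbed because h → ∞. -/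
theorem IsConcaveScale.frequently_le_of_tail_comparison {h F G : ℝ → ℝ} (hh : IsConcaveScale h)
    (hF : ∀ ε : ℝ, 0 < ε → ∃ᶠ x in atTop, Real.exp (-((1 + ε) * h x)) ≤ F x)
    (hFG : ∀ e : ℝ, 0 < e → ∃ c : ℝ, 0 < c ∧ ∀ᶠ x in atTop, c * F ((1 + e) * x) ≤ G x)
    {ε : ℝ} (hε : 0 < ε) : ∃ᶠ x in atTop, Real.exp (-((1 + ε) * h x)) ≤ G x := by
  -- The quarter ensures (1+e)² + e ≤ 1 + 4e ≤ 1 + ε.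
  set e := min ε 1 / 4 with he
  have he0 : 0 < e := by positivity
  have he1 : e ≤ ε / 4 := by
    have := min_le_left ε 1
    linarith
  have he2 : e ≤ 1 / 4 := by
    have := min_le_right ε 1
    linarith
  obtain ⟨c, hc0, hc⟩ := hFG e he0
  have ht : Tendsto (fun y : ℝ => y / (1 + e)) atTop atTop :=
    tendsto_id.atTop_div_const (by positivity)
  have hlarge : ∀ᶠ x in atTop, -Real.log c ≤ e * h x :=
    (hh.tendsto_atTop.const_mul_atTop he0).eventually_ge_atTop _
  have hev := ht.eventually (hc.and (hlarge.and (eventually_gt_atTop 0)))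
  refine ht.frequently (((hF e he0).and_eventually hev).mono fun y hy => ?_)
  obtain ⟨h1, h2, h3, h4⟩ := hy
  set x := y / (1 + e) with hx
  have hxy : (1 + e) * x = y := by rw [hx]; field_simp
  rw [hxy] at h2
  have h5 : h y ≤ (1 + e) * h x := by
    have := hh.mul_le (t := 1 / (1 + e)) (x := y) (by positivity)
      (by rw [div_le_one (by positivity)]; linarith) (by rw [← hxy]; positivity)
    rw [show 1 / (1 + e) * y = x by rw [hx]; ring, div_mul_eq_mul_div, one_mul,
      div_le_iff₀ (by positivity)] at this
    linarith
  refine le_trans ?_ h2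
  calc Real.exp (-((1 + ε) * h x)) ≤ Real.exp (Real.log c + -((1 + e) * h y)) := by
        rw [Real.exp_le_exp]
        have h6 := hh.nonneg x h4.le
        have h7 : (1 + e) * h y ≤ (1 + e) * ((1 + e) * h x) := by gcongr
        have h8 : (e * e) * h x ≤ e * h x := by
          refine mul_le_mul_of_nonneg_right ?_ h6
          nlinarith
        have h9 : 4 * e * h x ≤ ε * h x := mul_le_mul_of_nonneg_right (by linarith) h6
        nlinarith
    _ = c * Real.exp (-((1 + e) * h y)) := by rw [Real.exp_add, Real.exp_log hc0]
    _ ≤ c * F y := by gcongr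

theorem eventually_le_exp_of_scale_comparison {F g h : ℝ → ℝ} (hh : Tendsto h atTop atTop)
    (hF : ∀ ε : ℝ, 0 < ε → ∀ᶠ x in atTop, F x ≤ Real.exp (-((1 - ε) * g x)))
    (hgh : ∀ ε : ℝ, 0 < ε → ∀ᶠ x in atTop, (1 - ε) * h x ≤ g x) {ε : ℝ} (hε : 0 < ε) :
    ∀ᶠ x in atTop, F x ≤ Real.exp (-((1 - ε) * h x)) := by
  set e := min ε 1 / 2 with he
  have he0 : 0 < e := by positivity
  have he1 : e ≤ ε / 2 := by
    have := min_le_left ε 1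
    linarith
  have he2 : e ≤ 1 / 2 := by
    have := min_le_right ε 1
    linarith
  filter_upwards [hF e he0, hgh e he0, hh.eventually_ge_atTop 0] with x h1 h2 h3
  refine h1.trans (Real.exp_le_exp.2 (neg_le_neg ?_))
  have h4 := mul_le_mul_of_nonneg_left h2 (show 0 ≤ 1 - e by linarith)
  refine le_trans ?_ h4
  rw [← mul_assoc]
  refine mul_le_mul_of_nonneg_right ?_ h3
  nlinarith

theorem setOf_lt_const_mul {Ω : Type*} {Y : Ω → ℝ} {m : ℝ} (hm : 0 < m) (x : ℝ) :
    {ω | x < m * Y ω} = {ω | x / m < Y ω} := by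
  ext ω
  simp only [Set.mem_ofPred_eq]
  rw [div_lt_iff₀ hm, mul_comm]

variable {Ω : Type*} [MeasurableSpace Ω] {P : Measure Ω}

theorem IsNaturalScale.const_mul {Y : Ω → ℝ} {h : ℝ → ℝ}
    (hY : IsNaturalScale P Y h) {m : ℝ} (hm : 0 < m) :
    IsNaturalScale P (fun ω => m * Y ω) (fun x => h (x / m)) where
  heavyTailed s hs := by
    have := hY.heavyTailed (s * m) (by positivity)
    simpa only [mul_assoc] using this
  concaveOn := (hY.isConcaveScale.comp_div hm).concaveOn
  nonneg := (hY.isConcaveScale.comp_div hm).nonneg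
  map_zero := (hY.isConcaveScale.comp_div hm).map_zero
  tendsto_atTop := (hY.isConcaveScale.comp_div hm).tendsto_atTop
  liminf_eq := by
    have hfun : (fun x : ℝ => hazard P (fun ω => m * Y ω) x / (h (x / m) : EReal)) =
        (fun x : ℝ => hazard P Y x / (h x : EReal)) ∘ fun x => x / m := by
      funext x
      simp only [hazard, Function.comp, setOf_lt_const_mul hm]
    have hmap : map (fun x : ℝ => x / m) atTop = atTop :=
      (OrderIso.divRight₀ m hm).map_atTop
    rw [hfun, liminf, ← Filter.map_map, hmap]
    exact hY.liminf_eq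

end Comparison

/-! ### The common criterion and the two cases -/

section Main

variable {Ω : Type*} [MeasurableSpace Ω] {P : Measure Ω} [IsProbabilityMeasure P]
  {X : ℕ → Ω → ℝ} {N : Ω → ℕ}

theorem isNaturalScale_stoppedSum (hXm : ∀ i, Measurable (X i))
    (hNm : Measurable N) (hNpos : ∀ ω, 1 ≤ N ω) (hindep : iIndepFun X P)
    (hident : ∀ i, IdentDistrib (X i) (X 0) P P) (hNind : IndepFun N (fun ω i => X i ω) P)
    (hX : Integrable (X 0) P) (hmean : 0 < ∫ ω, X 0 ω ∂P) {h : ℝ → ℝ}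
    (hh : IsConcaveScale h) (hsub : Tendsto (fun x => h x / x) atTop (nhds 0)) {r : ℝ} (hr : 1 < r)
    (hlog : ∀ᶠ x : ℝ in atTop, r * Real.log x ≤ h x)
    (htailX : ∀ ε : ℝ, 0 < ε → ∀ᶠ x in atTop,
      P.real {ω | x < X 0 ω} ≤ Real.exp (-((1 - ε) * h x)))
    (htailN : ∀ ε : ℝ, 0 < ε → ∀ᶠ x in atTop,
      P.real {ω | x < (∫ ω', X 0 ω' ∂P) * N ω} ≤ Real.exp (-((1 - ε) * h x)))
    (hlow : ∀ ε : ℝ, 0 < ε → ∃ᶠ x in atTop,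
      Real.exp (-((1 + ε) * h x)) ≤ P.real {ω | x < stoppedSum X N ω}) :
    IsNaturalScale P (stoppedSum X N) h where
  heavyTailed := heavyTailed_of_frequently_le_tail (measurable_stoppedSum hXm hNm) hsub
    (by norm_num : (0 : ℝ) < 1 + 1) (hlow 1 one_pos)
  concaveOn := hh.concaveOn
  nonneg := hh.nonneg
  map_zero := hh.map_zero
  tendsto_atTop := hh.tendsto_atTop
  liminf_eq := le_antisymm ((liminf_hazard_div_le_one_iff hh.tendsto_atTop).2 hlow)
    ((one_le_liminf_hazard_div_iff hh.tendsto_atTop).2 fun _ hε =>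
      eventually_tail_stoppedSum_le hXm hNm hNpos hindep hident hNind hX hmean hh hsub hr hlog
        htailX htailN hε)

end Main

theorem theorem1 {Ω : Type*} [MeasurableSpace Ω] (P : Measure Ω) [IsProbabilityMeasure P]
    (X : ℕ → Ω → ℝ) (N : Ω → ℕ)
    (hX_meas : ∀ i, Measurable (X i)) (hN_meas : Measurable N)
    (hN_pos : ∀ ω, 1 ≤ N ω)
    -- the increments are IID, and `N` is independent of the whole sequence of increments
    (hX_indep : iIndepFun X P) (hX_ident : ∀ i, IdentDistrib (X i) (X 0) P P)
    (hN_indep : IndepFun N (fun ω i => X i ω) P)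
    (hX_heavy : HeavyTailed P (X 0)) (hN_heavy : HeavyTailed P (fun ω => (N ω : ℝ)))
    -- `0 < E(X) < ∞`
    (hX_int : Integrable (X 0) P) (hX_mean : 0 < ∫ ω, X 0 ω ∂P) :
    -- (1) the increment dominates
    (∀ δ : ℝ, 0 < δ →
      ∫⁻ ω, ENNReal.ofReal ((max (X 0 ω) 0) ^ (1 + δ)) ∂P < ⊤ →
      ∀ hX : ℝ → ℝ, IsNaturalScale P (X 0) hX →
      (∀ᶠ x : ℝ in atTop, (1 + δ) * Real.log x ≤ hX x) →
      (∃ hN : ℝ → ℝ, IsNaturalScale P (fun ω => (N ω : ℝ)) hN ∧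
        ∃ c₁ : ℝ, ∫ ω, X 0 ω ∂P < c₁ ∧
          1 ≤ liminf (fun x : ℝ => ((hN (x / c₁) / hX x : ℝ) : EReal)) atTop) →
      IsNaturalScale P (stoppedSum X N) hX) ∧
    -- (2) the stopping variable dominates
    (∀ δ : ℝ, 0 < δ →
      ∫⁻ ω, ENNReal.ofReal ((N ω : ℝ) ^ (1 + δ)) ∂P < ⊤ →
      ∀ hN : ℝ → ℝ, IsNaturalScale P (fun ω => (N ω : ℝ)) hN →
      (∀ᶠ x : ℝ in atTop, (1 + δ) * Real.log x ≤ hN x) →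
      (∃ hX : ℝ → ℝ, IsNaturalScale P (X 0) hX ∧
        1 ≤ liminf (fun x : ℝ => ((hX x / hN (x / ∫ ω, X 0 ω ∂P) : ℝ) : EReal)) atTop) →
      IsNaturalScale P (fun ω => (∫ ω', X 0 ω' ∂P) * (N ω : ℝ))
          (fun x => hN (x / ∫ ω, X 0 ω ∂P)) ∧
        IsNaturalScale P (stoppedSum X N) (fun x => hN (x / ∫ ω, X 0 ω ∂P))) := by
  refine ⟨?_, ?_⟩
  · rintro δ hδ - h hXs hlog ⟨hN, hNs, c₁, hc₁, hlim⟩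
    have hh := hXs.isConcaveScale
    have hsub := hX_heavy.tendsto_div_zero (c := 1 - 1 / 2) (hX_meas 0) hh (by norm_num)
      (hXs.eventually_tail_le (by norm_num))
    refine isNaturalScale_stoppedSum hX_meas hN_meas hN_pos hX_indep hX_ident hN_indep hX_int
      hX_mean hh hsub (by linarith : 1 < 1 + δ) hlog (fun ε hε => hXs.eventually_tail_le hε)
      (fun ε hε => ?_) (fun ε hε => ?_)
    · refine eventually_le_exp_of_scale_comparison hh.tendsto_atTop
        (fun e he => (hNs.const_mul hX_mean).eventually_tail_le he) (fun e he => ?_) hε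
      filter_upwards [eventually_mul_le_of_one_le_liminf_div hh.tendsto_atTop hlim he,
        eventually_ge_atTop 0] with x hx hx0
      -- As c₁ > E(X) and the scale of N is monotone, passing from x/c₁ to x/E(X) only increases it.
      refine hx.trans (hNs.isConcaveScale.mono (by have := hX_mean.trans hc₁; positivity) ?_)
      exact div_le_div_of_nonneg_left hx0 hX_mean hc₁.le
    · refine hh.frequently_le_of_tail_comparison (F := fun x => P.real {ω | x < X 0 ω})
        (fun e he => hXs.frequently_le_tail he) (fun e he => ?_) hε
      obtain ⟨c, K, hc, hK, hcK⟩ :=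
        exists_mul_tail_le_tail_stoppedSum hN_pos hX_indep hX_ident hN_indep
      refine ⟨c, hc, ?_⟩
      filter_upwards [eventually_ge_atTop (K / e)] with x hx
      rw [div_le_iff₀ he] at hx
      refine le_trans (mul_le_mul_of_nonneg_left (measureReal_mono fun ω hω => ?_) hc.le) (hcK x)
      exact lt_of_le_of_lt (by linarith : x + K ≤ (1 + e) * x) hω
  · rintro δ hδ - hN hNs hlog ⟨hX, hXs, hlim⟩
    set m := ∫ ω, X 0 ω ∂P with hm
    have hs := hNs.const_mul hX_mean
    refine ⟨hs, ?_⟩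
    have hh := hs.isConcaveScale
    have hYm : Measurable fun ω => m * (N ω : ℝ) :=
      ((measurable_of_countable (fun n : ℕ => (n : ℝ))).comp hN_meas).const_mul m
    have hsub := hs.heavyTailed.tendsto_div_zero (c := 1 - 1 / 2) hYm hh (by norm_num)
      (hs.eventually_tail_le (by norm_num))
    -- Half of δ is given up to absorb the constant log m produced by rescaling.
    have hlog' : ∀ᶠ x : ℝ in atTop, (1 + δ / 2) * Real.log x ≤ hN (x / m) := by
      filter_upwards [(tendsto_id.atTop_div_const hX_mean).eventually hlog,
        Real.tendsto_log_atTop.eventually_ge_atTop ((1 + δ) * Real.log m / (δ / 2)),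
        eventually_gt_atTop 0] with x h1 h2 h3
      simp only [id] at h1
      rw [Real.log_div h3.ne' hX_mean.ne'] at h1
      rw [div_le_iff₀ (by positivity)] at h2
      linarith
    refine isNaturalScale_stoppedSum hX_meas hN_meas hN_pos hX_indep hX_ident hN_indep hX_int
      hX_mean hh hsub (by linarith : 1 < 1 + δ / 2) hlog' (fun ε hε => ?_)
      (fun ε hε => hs.eventually_tail_le hε) (fun ε hε => ?_)
    · exact eventually_le_exp_of_scale_comparison hh.tendsto_atTop
        (fun e he => hXs.eventually_tail_le he)
        (fun e he => eventually_mul_le_of_one_le_liminf_div hh.tendsto_atTop hlim he) hε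
    · refine hh.frequently_le_of_tail_comparison (F := fun x => P.real {ω | x < m * N ω})
        (fun e he => hs.frequently_le_tail he) (fun e he => ⟨1 / 2, by norm_num, ?_⟩) hε
      -- The dilation by 1 + e is what brings the slope strictly below the mean, as the law of large
      -- numbers requires.
      have hcm : m / (1 + e) < m := div_lt_self hX_mean (by linarith)
      filter_upwards [eventually_half_mul_tail_le_tail_stoppedSum hX_meas hN_meas hX_indep
        hX_ident hN_indep hX_int (div_pos hX_mean (by linarith : 0 < 1 + e)) hcm] with x hx
      have hset : {ω | (1 + e) * x < m * (N ω : ℝ)} = {ω | x < m / (1 + e) * N ω} := by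
        ext ω
        simp only [Set.mem_ofPred_eq]
        rw [div_mul_eq_mul_div, lt_div_iff₀ (by positivity), mul_comm x]
      rw [hset]
      exact hx
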